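/- **Setting.** Let $G_\infty=(V,E)$ be an infinite, locally finite, connected graph (multiple edges and self-loops allowed), $d$ its graph distance, $B(x,R)$ its closed balls, and let $G_0\subseteq G_1\subseteq\cdots$ be subgraphs of $G_\infty$ whose edge sets $E_t$ increase to $E$. Let $V_t$ be the set of vertices joined in $G_t$ to some other vertex; assume that $V_t$ is finite and that $(V_t,E_t)$ is connected. Let $\pi^{(t)}(x,y)$ be the number of edges of $G_t$ between $x$ and $y$, $\pi^{(t)}(x)=\sum_y\pi^{(t)}(x,y)$, $\pi^{(t)}(A)=\sum_{x\in A}\pi^{(t)}(x)$, $v(t)=\pi^{(t)}(V_t)$, define $\pi^{(\infty)}$ in the same way from $G_\infty$, write $v(B)=\pi^{(\infty)}(B)$ for a ball $B$, and let $$\Phi_t=\min\Big\{\frac{\pi^{(t)}(A,V_t\setminus A)}{\pi^{(t)}(A)}:\ \emptyset\ne A\subseteq V_t,\ \pi^{(t)}(A)\le \tfrac{v(t)}2\Big\},\qquad \pi^{(t)}(A,B)=\sum_{x\in A,\,y\in B}\pi^{(t)}(x,y).$$ Fix $x_0\in V_0$. Let $(X_t)_{t\in\mathbb N}$ be the Markov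 chain with $X_0=x_0$ and $\mathbb P(X_{t+1}=y\mid X_t=x)=\pi^{(t)}(x,y)/\pi^{(t)}(x)$ for $x,y\in V_t$, and put $P(0,x_0;t,y)=\mathbb P(X_t=y)$. The chain is *weakly recurrent* if $\mathbb E\big[\sum_{t\ge0}1_{\{X_t=x_0\}}\big]=\infty$. For $\psi:(0,\infty)\to(0,\infty)$ continuous and non-decreasing, $G_\infty$ satisfies LLE($\psi$) if for every $\delta\in(0,1)$ there is $c_{\rm HK}(\delta)>0$ such that for all real $m\ge1$ and all $x,y\in B(x_0,(1-\delta)m)\setminus\partial B(x_0,m)$, $$\mathbb P_x\big(Y_{\lfloor\psi(m)\rfloor}=y,\ \lfloor\psi(m)\rfloor<\tau\big)\ \ge\ \frac{c_{\rm HK}(\delta)}{v(B(x_0,m))},$$ where $Y$ is simple random walk on $G_\infty$, $\partial B(x_0,m)$ is the set of vertices of $B(x_0,m)$ that have a $G_\infty$-neighbour outside $B(x_0,m)$, and $\tau\ge0$ is the first hitting time of $\partial B(x_0,m)$ by $Y$. **Proposition.** Assume that 1. for some $\gamma\in(0,\frac12]$ and $\Delta<\infty$, $\pi^{(t)}(x,x)\ge\gamma\,\pi^{(t)}(x)$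 and $\pi^{(t)}(x)\le\Delta$ for all $t$ and $x\in V_t$; 2. $v(B(x,2R))\le D_1v(B(x,R))$ for all $x\in V$, $R>0$, and $G_\infty$ satisfies LLE($\psi$) with constants $c_{\rm HK}(\cdot)$; 3. there is a continuous non-decreasing $r:[0,\infty)\to(0,\infty)$ such that for every $t\in\mathbb N$ the graph $G_t$ contains the ball $B(x_0,r(t))$ together with all edges of $G_\infty$ between its vertices, and $\big(v(t)-v(B(x_0,r(t)))\big)/v(t)\to0$ as $t\to\infty$; 4. $\displaystyle\liminf_{t\to\infty}\ \frac{\sum_{u=\lfloor t/2\rfloor}^{t-1}\Phi_u^2}{\log v(\lfloor t/2\rfloor)}\ \ge\ \zeta$ for some real $\zeta>0$; 5. $v(2t)\le D_2v(t)$ for all integers $t\ge1$. Put $r^{-1}(m)=\inf\{s\ge0:r(s)\ge m\}$ and $(r^{-1}+\psi)^{-1}(t)=\sup\{m>0:r^{-1}(m)+\psi(m)\le t\}$ (and $0$ if there is no such $m$). Then there are $\delta_0\in(0,\frac12]$ depending only on $\gamma,\Delta,\zeta,D_1,D_2$, and $c>0$ depending only on these and on $c_{\rm HK}(\cdot)$,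 with the following properties. * There is $t_0$ (which may depend on the whole sequence of graphs) such that for all integers $t\ge t_0$ and all $y\in V_t$ with $d(x_0,y)\le(1-\delta_0)(r^{-1}+\psi)^{-1}(t)$, $$P(0,x_0;t,y)\ \ge\ \frac{c}{v(t)} .$$ * The same bound holds for all integers $t\ge2$ and all such $y$ if $c$ is replaced by some $c'>0$ that may depend on the whole sequence of graphs. * If $\sum_{t}1/v(t)=\infty$, then $(X_t)$ is weakly recurrent. -/

import Mathlib

/-- An undirected graph on the vertex type `V`, multiple edges and self-loops allowed, recorded by
the number `mult x y` of edges joining `x` and `y` (`mult x x` is the number of loops at `x`). -/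
structure MultiGraph (V : Type*) where
  mult : V → V → ℕ
  symm : ∀ x y, mult x y = mult y x

namespace MultiGraph

variable {V : Type*}

/-- The underlying simple graph, used for connectedness and for the graph distance. -/
def toSimple (G : MultiGraph V) : SimpleGraph V where
  Adj x y := x ≠ y ∧ G.mult x y ≠ 0
  symm := ⟨fun x y h => ⟨h.1.symm, by rw [G.symm y x]; exact h.2⟩⟩
  loopless := ⟨fun _ h => h.1 rfl⟩

/-- The set of non-isolated vertices: those joined to some other vertex. -/
def verts (G : MultiGraph V) : Set V := {x | ∃ y, y ≠ x ∧ G.mult x y ≠ 0}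

/-- `π(x)`: the number of edges at `x`, each loop counted once. -/
noncomputable def degree (G : MultiGraph V) (x : V) : ℕ := ∑ᶠ y, G.mult x y

/-- `π(A) = ∑_{x ∈ A} π(x)`, for finite `A`. -/
noncomputable def volume (G : MultiGraph V) (A : Set V) : ℝ := ∑ᶠ x ∈ A, (G.degree x : ℝ)

/-- `π(A, B) = ∑_{x ∈ A, y ∈ B} π(x, y)`, for finite `A`, `B`. -/
noncomputable def edgeCount (G : MultiGraph V) (A B : Set V) : ℝ :=
  ∑ᶠ x ∈ A, ∑ᶠ y ∈ B, (G.mult x y : ℝ)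

/-- The volume `v = π(V_G)` of a finite graph, `V_G` being the non-isolated vertices. -/
noncomputable def totalVolume (G : MultiGraph V) : ℝ := G.volume G.verts

/-- The Cheeger constant: the infimum of `π(A, V_G \ A) / π(A)` over the nonempty `A ⊆ V_G` with
`π(A) ≤ v / 2`. (Such `A` exist for a finite graph with a non-loop edge: a vertex of least
degree.) -/
noncomputable def cheeger (G : MultiGraph V) : ℝ :=
  sInf {a : ℝ | ∃ A : Set V, A ⊆ G.verts ∧ A.Nonempty ∧ G.volume A ≤ G.totalVolume / 2 ∧
    a = G.edgeCount A (G.verts \ A) / G.volume A}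

/-- One-step transition probability of simple random walk. -/
noncomputable def step (G : MultiGraph V) (x y : V) : ℝ := (G.mult x y : ℝ) / (G.degree x : ℝ)

/-- The closed ball of (real) radius `R` in the graph distance of `G`. -/
def ball (G : MultiGraph V) (x : V) (R : ℝ) : Set V := {y | (G.toSimple.dist x y : ℝ) ≤ R}

/-- The inner boundary of `H` relative to `G`. -/
def innerBoundary (G : MultiGraph V) (H : Set V) : Set V :=
  {x | x ∈ H ∧ ∃ y, y ∉ H ∧ G.mult x y ≠ 0}

open Classical in
/-- `killed S k x y = P_x(Y_k = y, k < τ)`, for simple random walk `Y` on `G` and `τ ≥ 0` the first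
time that `Y` is in `S`. -/
noncomputable def killed (G : MultiGraph V) (S : Set V) : ℕ → V → V → ℝ
  | 0, x, y => if x = y ∧ y ∉ S then 1 else 0
  | k + 1, x, y => if y ∈ S then 0 else ∑ᶠ z, G.killed S k x z * G.step z y

/-- Volume doubling with constant `D`, for all centres and all radii. -/
def VolumeDoubling (G : MultiGraph V) (D : ℝ) : Prop :=
  ∀ (x : V) (R : ℝ), 0 < R → G.volume (G.ball x (2 * R)) ≤ D * G.volume (G.ball x R)

/-- The local lower estimate LLE(ψ) around `x₀`, with constants `cHK δ`, `δ ∈ (0, 1)`: the walk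
killed on the inner boundary of `B(x₀, m)` satisfies `p_{ψ(m)}(x, y) ≥ cHK δ / v(B(x₀, m))` for all
real `m ≥ 1` and `x, y ∈ B(x₀, (1 - δ) m)`. Times are rounded down. Points of the inner boundary
itself, where the killed kernel is identically zero, are left out; they occur only if `m` is not an
integer and `δ m < 1`. -/
def LLE (G : MultiGraph V) (x₀ : V) (ψ cHK : ℝ → ℝ) : Prop :=
  ∀ δ : ℝ, 0 < δ → δ < 1 → ∀ m : ℝ, 1 ≤ m →
    ∀ x ∈ G.ball x₀ ((1 - δ) * m) \ G.innerBoundary (G.ball x₀ m),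
    ∀ y ∈ G.ball x₀ ((1 - δ) * m) \ G.innerBoundary (G.ball x₀ m),
      cHK δ / G.volume (G.ball x₀ m) ≤
        G.killed (G.innerBoundary (G.ball x₀ m)) ⌊ψ m⌋₊ x y

end MultiGraph

/-- A sequence of finite connected graphs `graph 0 ⊆ graph 1 ⊆ ...` (connected on their
non-isolated vertices) that increases to a locally finite connected graph `limit`. -/
structure GrowingGraph (V : Type*) where
  limit : MultiGraph V
  graph : ℕ → MultiGraph V
  locallyFinite : ∀ x, {y | limit.mult x y ≠ 0}.Finite
  limit_connected : limit.toSimple.Connected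
  mono : ∀ t x y, (graph t).mult x y ≤ (graph (t + 1)).mult x y
  le_limit : ∀ t x y, (graph t).mult x y ≤ limit.mult x y
  exhausts : ∀ x y, ∃ t, (graph t).mult x y = limit.mult x y
  finite_verts : ∀ t, (graph t).verts.Finite
  connected : ∀ t, ∀ x ∈ (graph t).verts, ∀ y ∈ (graph t).verts,
    (graph t).toSimple.Reachable x y

namespace GrowingGraph

variable {V : Type*}

/-- `V_t`. -/
def verts (𝒢 : GrowingGraph V) (t : ℕ) : Set V := (𝒢.graph t).verts

/-- `v(t)`. -/
noncomputable def vol (𝒢 : GrowingGraph V) (t : ℕ) : ℝ := (𝒢.graph t).totalVolume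

open Classical in
/-- `P(0, x₀; t, y)`: the `t`-step transition probability of the walk whose step from time `u` to
time `u + 1` is a simple random walk step on `graph u`. -/
noncomputable def transProb (𝒢 : GrowingGraph V) (x₀ : V) : ℕ → V → ℝ
  | 0, y => if y = x₀ then 1 else 0
  | t + 1, y => ∑ᶠ z, 𝒢.transProb x₀ t z * (𝒢.graph t).step z y

/-- Uniform `γ`-laziness of the walk. -/
def Lazy (𝒢 : GrowingGraph V) (γ : ℝ) : Prop :=
  ∀ t, ∀ x ∈ 𝒢.verts t, γ ≤ (𝒢.graph t).step x x

/-- Uniformly bounded degrees. -/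
def DegreeBound (𝒢 : GrowingGraph V) (Δ : ℝ) : Prop :=
  ∀ t, ∀ x ∈ 𝒢.verts t, ((𝒢.graph t).degree x : ℝ) ≤ Δ

/-- The ball-like condition: `graph t` contains the ball `B(x₀, r(t))` of the limit graph with all
the edges that the limit graph has inside this ball, and `(v(t) - v(B(x₀, r(t)))) / v(t) → 0`, where
the volume of a ball is taken in the limit graph. -/
structure BallLike (𝒢 : GrowingGraph V) (x₀ : V) (r : ℝ → ℝ) : Prop where
  continuousOn : ContinuousOn r (Set.Ici 0)
  monotoneOn : MonotoneOn r (Set.Ici 0)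
  pos : ∀ s, 0 ≤ s → 0 < r s
  ball_subset : ∀ t : ℕ, 𝒢.limit.ball x₀ (r t) ⊆ 𝒢.verts t
  ball_induced : ∀ t : ℕ, ∀ x ∈ 𝒢.limit.ball x₀ (r t), ∀ y ∈ 𝒢.limit.ball x₀ (r t),
    (𝒢.graph t).mult x y = 𝒢.limit.mult x y
  tendsto : Filter.Tendsto
    (fun t : ℕ => (𝒢.vol t - 𝒢.limit.volume (𝒢.limit.ball x₀ (r t))) / 𝒢.vol t)
    Filter.atTop (nhds 0)

/-- The regularity condition: the lower limit of
`∑_{u = ⌊t/2⌋}^{t - 1} Φ_u ^ 2 / log v(⌊t/2⌋)` (possibly `+∞`) is at least `ζ`. -/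
def Regular (𝒢 : GrowingGraph V) (ζ : ℝ) : Prop :=
  (ζ : EReal) ≤ Filter.liminf (fun t : ℕ =>
    (((∑ u ∈ Finset.Ico (t / 2) t, (𝒢.graph u).cheeger ^ 2) / Real.log (𝒢.vol (t / 2)) : ℝ) :
      EReal)) Filter.atTop

/-- `t ↦ v(t)` is doubling with constant `D`. -/
def VolDoubling (𝒢 : GrowingGraph V) (D : ℝ) : Prop :=
  ∀ t : ℕ, 1 ≤ t → 𝒢.vol (2 * t) ≤ D * 𝒢.vol t

/-- `X` is a simple random walk on the growing graph started at `x₀`: a process with `X_0 = x₀`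
almost surely which, given the past up to time `t` and `X_t = x`, jumps to `y` with probability
`π^{(t)}(x, y) / π^{(t)}(x)`. -/
structure IsWalk (𝒢 : GrowingGraph V) (x₀ : V) {Ω : Type*} [MeasurableSpace Ω]
    (μ : MeasureTheory.Measure Ω) (X : ℕ → Ω → V) : Prop where
  measurable : ∀ t, @Measurable Ω V _ ⊤ (X t)
  start : ∀ᵐ ω ∂μ, X 0 ω = x₀
  markov : ∀ (t : ℕ) (A : Set Ω),
    @MeasurableSet Ω (⨆ i : ℕ, ⨆ _ : i ≤ t, MeasurableSpace.comap (X i) ⊤) A →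
    ∀ x ∈ 𝒢.verts t, ∀ y : V,
      μ (A ∩ {ω | X t ω = x} ∩ {ω | X (t + 1) ω = y}) =
        μ (A ∩ {ω | X t ω = x}) * ENNReal.ofReal ((𝒢.graph t).step x y)

end GrowingGraph

/-- Weak recurrence: the expected number of visits of `X` to its starting point is infinite. -/
def WeaklyRecurrent {V Ω : Type*} [MeasurableSpace Ω] (μ : MeasureTheory.Measure Ω)
    (X : ℕ → Ω → V) (x₀ : V) : Prop :=
  ∫⁻ ω, ∑' t : ℕ, Set.indicator {ω' | X t ω' = x₀} (fun _ => (1 : ENNReal)) ω ∂μ = ⊤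

/-- The generalized inverse `r⁻¹(m) = inf {s ≥ 0 : r(s) ≥ m}` of a non-decreasing function on
`[0, ∞)`. -/
noncomputable def genInv (r : ℝ → ℝ) (m : ℝ) : ℝ := sInf {s : ℝ | 0 ≤ s ∧ m ≤ r s}

/-- `(r⁻¹ + ψ)⁻¹(t) = sup {m > 0 : r⁻¹(m) + ψ(m) ≤ t}` (and `0` if there is no such `m`). -/
noncomputable def reach (r ψ : ℝ → ℝ) (t : ℝ) : ℝ := sSup {m : ℝ | 0 < m ∧ genInv r m + ψ m ≤ t}

/-! An upper bound on the `L²` norm of the density, turned into concentration of the walk in a ball,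
feeds a single application of LLE.

Upper bound. Let the energy at time t be the sum over y of P(0,x₀;t,y)² / π^{(t)}(y). Growth of the
graph can only lower it: the degrees in the denominators increase, and the walk at time t+1 still
lives on V_t. A step of the walk contracts its excess over 4/v(t) by the factor 1 - γΦ_t²/2, by
laziness and Cheeger's inequality for the density truncated at 2/v(t) (`energy_succ_le`). Over a
fixed number of dyadic time blocks, regularity makes the accumulated contraction at most 1/v, and
doubling of v then bounds the energy by C/v(t) (`eventually_energy_le`).

Concentration. By Cauchy-Schwarz the squared probability of a set is at most energy times volume.
The part of V_t outside B(x₀, (1-δ)² r(t)) has a small share of v(t), since V_t is ball-like and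
doubling makes thin annuli negligible (`exists_volume_ball_ge`). Hence the walk is in that ball with
probability at least 1/2 (`eventually_half_le`).

Lower bound. Choose s with s + ψ((1-δ) r(s)) = t. After time s the transitions inside the ball of
radius (1-δ) r(s) are those of the limit graph, so the walk dominates the limit walk killed at the
inner boundary, and LLE carries the mass at time s to every admissible y (`eventually_lower_bound`).
The finitely many earlier times need only positivity, and summing the bound at x₀ gives weak
recurrence. -/

/-! ### Isoperimetry and `L²` contraction on a finite weighted graph. -/

/-- Coarea inequality: an isoperimetric inequality for small sets extends to non-negative functions
supported on a small set. -/
theorem coarea_inequality {V : Type*} [DecidableEq V] (W : Finset V) (m : V → V → ℝ) (p : V → ℝ)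
    (Φ B : ℝ) (hsymm : ∀ x y, m x y = m y x) (hp : ∀ x ∈ W, 0 ≤ p x)
    (hΦ : ∀ S ⊆ W, S.Nonempty → ∑ x ∈ S, p x ≤ B →
      Φ * ∑ x ∈ S, p x ≤ ∑ x ∈ S, ∑ y ∈ W \ S, m x y) (n : ℕ) :
    ∀ S : Finset V, S.card = n → S ⊆ W → ∑ x ∈ S, p x ≤ B → ∀ g : V → ℝ, (∀ x ∈ S, 0 ≤ g x) →
      (∀ x, x ∉ S → g x = 0) →
      2 * Φ * ∑ x ∈ W, p x * g x ≤ ∑ x ∈ W, ∑ y ∈ W, m x y * |g x - g y| := by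
  induction n with
  | zero =>
    intro S hc _ _ g _ hg0
    have : S = ∅ := Finset.card_eq_zero.1 hc
    subst this
    have h0 : ∀ x, g x = 0 := fun x => hg0 x (by simp)
    simp [h0]
  | succ n ih =>
    intro S hc hSW hB g hg hg0
    have hne : S.Nonempty := Finset.card_pos.1 (by omega)
    obtain ⟨x₁, hx₁, hmin⟩ := S.exists_min_image g hne
    set a := g x₁ with ha
    have ha0 : 0 ≤ a := hg x₁ hx₁
    set i : V → ℝ := fun x => if x ∈ S then 1 else 0 with hi
    -- Peel off the lowest layer: `g'` also vanishes at the minimiser `x₁`, so its support loses a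
    -- point and the induction applies.
    set g' : V → ℝ := fun x => g x - a * i x with hg'
    have key := ih (S.erase x₁) (by rw [Finset.card_erase_of_mem hx₁]; omega)
      ((Finset.erase_subset _ _).trans hSW)
      ((Finset.sum_le_sum_of_subset_of_nonneg (Finset.erase_subset _ _)
        (fun x hx _ => hp x (hSW hx))).trans hB) g'
      (by
        intro x hx
        have hxS := Finset.mem_of_mem_erase hx
        simp only [hg', hi, hxS, if_true, mul_one]
        linarith [hmin x hxS])
      (by
        intro x hx
        by_cases hxS : x ∈ S
        · have : x = x₁ := by
            by_contra h
            exact hx (Finset.mem_erase.2 ⟨h, hxS⟩)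
          subst this
          simp [hg', hi, hxS, ha]
        · simp [hg', hi, hxS, hg0 x hxS])
    -- No cancellation occurs: `g` is at least `a` on `S` and zero off `S`.
    have habs : ∀ x y, |g x - g y| = a * |i x - i y| + |g' x - g' y| := by
      intro x y
      by_cases hx : x ∈ S <;> by_cases hy : y ∈ S
      · simp [hg', hi, hx, hy]
      · have := hmin x hx
        simp only [hg', hi, hx, hy, if_true, if_false, hg0 y hy]
        rw [abs_of_nonneg (by linarith), abs_of_nonneg (by linarith), abs_of_nonneg (by linarith)]
        ring
      · have := hmin y hy
        simp only [hg', hi, hx, hy, if_true, if_false, hg0 x hx]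
        rw [abs_of_nonpos (by linarith), abs_of_nonpos (by linarith), abs_of_nonpos (by linarith)]
        ring
      · simp [hg', hi, hx, hy]
    -- The factor 2 arises because each cut edge is seen in both orders.
    have hcut : ∑ x ∈ W, ∑ y ∈ W, m x y * |i x - i y| = 2 * ∑ x ∈ S, ∑ y ∈ W \ S, m x y := by
      have h1 : ∑ x ∈ W, ∑ y ∈ W, m x y * |i x - i y| =
          (∑ x ∈ S, ∑ y ∈ W \ S, m x y) + ∑ x ∈ W \ S, ∑ y ∈ S, m x y := by
        rw [← Finset.sum_sdiff hSW, add_comm]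
        congr 1
        · refine Finset.sum_congr rfl fun x hx => ?_
          rw [← Finset.sum_sdiff hSW]
          rw [Finset.sum_eq_zero (s := S) (fun y hy => by simp [hi, hx, hy]), add_zero]
          refine Finset.sum_congr rfl fun y hy => ?_
          simp [hi, hx, (Finset.mem_sdiff.1 hy).2]
        · refine Finset.sum_congr rfl fun x hx => ?_
          have hx' := (Finset.mem_sdiff.1 hx).2
          rw [← Finset.sum_sdiff hSW]
          rw [Finset.sum_eq_zero (s := W \ S)
            (fun y hy => by simp [hi, hx', (Finset.mem_sdiff.1 hy).2]), zero_add]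
          refine Finset.sum_congr rfl fun y hy => ?_
          simp [hi, hx', hy]
      rw [h1, Finset.sum_comm (s := W \ S)]
      simp only [fun x y => hsymm y x]
      ring_nf
    have hpsum : ∑ x ∈ W, p x * i x = ∑ x ∈ S, p x := by
      rw [← Finset.sum_subset hSW (fun x _ hx => by simp [hi, hx])]
      exact Finset.sum_congr rfl fun x hx => by simp [hi, hx]
    have hlhs : ∑ x ∈ W, p x * g x = a * ∑ x ∈ S, p x + ∑ x ∈ W, p x * g' x := by
      rw [← hpsum, Finset.mul_sum, ← Finset.sum_add_distrib]
      exact Finset.sum_congr rfl fun x _ => by simp only [hg']; ring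
    have hrhs : ∑ x ∈ W, ∑ y ∈ W, m x y * |g x - g y| =
        a * (∑ x ∈ W, ∑ y ∈ W, m x y * |i x - i y|) +
          ∑ x ∈ W, ∑ y ∈ W, m x y * |g' x - g' y| := by
      simp only [Finset.mul_sum, ← Finset.sum_add_distrib]
      refine Finset.sum_congr rfl fun x _ => Finset.sum_congr rfl fun y _ => ?_
      rw [habs]; ring
    rw [hlhs, hrhs, hcut]
    have := mul_le_mul_of_nonneg_left (hΦ S hSW hne hB) ha0
    nlinarith

/-- Cheeger's inequality for functions supported on a small set. -/
theorem cheeger_inequality {V : Type*} [DecidableEq V] (W : Finset V) (m : V → V → ℝ) (p : V → ℝ)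
    (Φ B : ℝ) (hsymm : ∀ x y, m x y = m y x) (hm : ∀ x y, 0 ≤ m x y)
    (hpm : ∀ x ∈ W, p x = ∑ y ∈ W, m x y) (hΦ0 : 0 ≤ Φ)
    (hΦ : ∀ S ⊆ W, S.Nonempty → ∑ x ∈ S, p x ≤ B →
      Φ * ∑ x ∈ S, p x ≤ ∑ x ∈ S, ∑ y ∈ W \ S, m x y)
    (S : Finset V) (hSW : S ⊆ W) (hB : ∑ x ∈ S, p x ≤ B) (h : V → ℝ) (hh : ∀ x ∈ S, 0 ≤ h x)
    (hh0 : ∀ x, x ∉ S → h x = 0) :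
    Φ ^ 2 * ∑ x ∈ W, p x * h x ^ 2 ≤ ∑ x ∈ W, ∑ y ∈ W, m x y * (h x - h y) ^ 2 := by
  have hp : ∀ x ∈ W, 0 ≤ p x := fun x hx => by
    rw [hpm x hx]; exact Finset.sum_nonneg fun y _ => hm x y
  have hnn : ∀ x, 0 ≤ h x := fun x => by
    by_cases hx : x ∈ S
    · exact hh x hx
    · rw [hh0 x hx]
  have h1 := coarea_inequality W m p Φ B hsymm hp hΦ S.card S rfl hSW hB (fun x => h x ^ 2)
    (fun x _ => sq_nonneg _) (fun x hx => by simp [hh0 x hx])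
  set N := ∑ x ∈ W, p x * h x ^ 2 with hN
  set E := ∑ x ∈ W, ∑ y ∈ W, m x y * (h x - h y) ^ 2 with hE
  have hN0 : 0 ≤ N := Finset.sum_nonneg fun x hx => mul_nonneg (hp x hx) (sq_nonneg _)
  have hE0 : 0 ≤ E := Finset.sum_nonneg fun x _ => Finset.sum_nonneg fun y _ =>
    mul_nonneg (hm x y) (sq_nonneg _)
  have hF : ∑ x ∈ W, ∑ y ∈ W, m x y * (h x + h y) ^ 2 ≤ 4 * N := by
    have hA : ∑ x ∈ W, ∑ y ∈ W, m x y * h x ^ 2 = N := by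
      refine Finset.sum_congr rfl fun x hx => ?_
      rw [hpm x hx, Finset.sum_mul]
    have hA' : ∑ x ∈ W, ∑ y ∈ W, m x y * h y ^ 2 = N := by
      rw [Finset.sum_comm, ← hA]
      exact Finset.sum_congr rfl fun x _ => Finset.sum_congr rfl fun y _ => by rw [hsymm]
    calc _ ≤ ∑ x ∈ W, ∑ y ∈ W, (2 * (m x y * h x ^ 2) + 2 * (m x y * h y ^ 2)) := by
          refine Finset.sum_le_sum fun x _ => Finset.sum_le_sum fun y _ => ?_
          nlinarith [hm x y, mul_nonneg (hm x y) (sq_nonneg (h x - h y))]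
      _ = 4 * N := by
          simp only [Finset.sum_add_distrib, ← Finset.mul_sum, hA, hA']; ring
  -- The coarea inequality was applied to `h ^ 2`; factor the difference of squares and use
  -- Cauchy-Schwarz.
  have hCS : (∑ x ∈ W, ∑ y ∈ W, m x y * |h x ^ 2 - h y ^ 2|) ^ 2 ≤
      E * ∑ x ∈ W, ∑ y ∈ W, m x y * (h x + h y) ^ 2 := by
    rw [hE]
    simp only [← Finset.sum_product']
    refine Finset.sum_sq_le_sum_mul_sum_of_sq_le_mul _ (fun z _ => mul_nonneg (hm _ _) (sq_nonneg _))
      (fun z _ => mul_nonneg (hm _ _) (sq_nonneg _)) (fun z _ => ?_)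
    rw [mul_pow, sq_abs]
    exact le_of_eq (by ring)
  have h2 : (2 * Φ * N) ^ 2 ≤ E * (4 * N) :=
    (pow_le_pow_left₀ (by positivity) h1 2).trans
      (hCS.trans (mul_le_mul_of_nonneg_left hF hE0))
  rcases hN0.eq_or_lt with h0 | hpos
  · rw [← h0]; simpa using hE0
  · have : Φ ^ 2 * N * (4 * N) ≤ E * (4 * N) := by nlinarith
    exact le_of_mul_le_mul_right this (by linarith)

/-- One step of a lazy reversible walk contracts the squared `L²` norm of a probability density at a
rate given by the isoperimetric constant, as long as it is well above the equilibrium value. -/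
theorem lazy_step_sq_le {V : Type*} [DecidableEq V] (W : Finset V) (m : V → V → ℝ) (p : V → ℝ)
    (Φ γ v : ℝ) (hsymm : ∀ x y, m x y = m y x) (hm : ∀ x y, 0 ≤ m x y)
    (hpm : ∀ x ∈ W, p x = ∑ y ∈ W, m x y) (hp : ∀ x ∈ W, 0 < p x) (hΦ0 : 0 ≤ Φ) (hv : 0 < v)
    (hγ : 0 < γ) (hlazy : ∀ x ∈ W, γ * p x ≤ m x x)
    (hΦ : ∀ S ⊆ W, S.Nonempty → ∑ x ∈ S, p x ≤ v / 2 →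
      Φ * ∑ x ∈ S, p x ≤ ∑ x ∈ S, ∑ y ∈ W \ S, m x y)
    (f : V → ℝ) (hf : ∀ x, 0 ≤ f x) (hf1 : ∑ x ∈ W, p x * f x = 1) :
    ∑ y ∈ W, (∑ z ∈ W, m y z * f z) ^ 2 / p y ≤ ∑ x ∈ W, p x * f x ^ 2 ∧
    ∑ y ∈ W, (∑ z ∈ W, m y z * f z) ^ 2 / p y ≤
      ∑ x ∈ W, p x * f x ^ 2 - γ / 2 * Φ ^ 2 * (∑ x ∈ W, p x * f x ^ 2 - 4 / v) := by
  set N := ∑ x ∈ W, p x * f x ^ 2 with hN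
  set E := ∑ x ∈ W, ∑ y ∈ W, m x y * (f x - f y) ^ 2 with hE
  have hE0 : 0 ≤ E := Finset.sum_nonneg fun x _ => Finset.sum_nonneg fun y _ =>
    mul_nonneg (hm x y) (sq_nonneg _)
  have hdrop : ∑ y ∈ W, (∑ z ∈ W, m y z * f z) ^ 2 / p y ≤ N - γ / 2 * E := by
    have hpt : ∀ x ∈ W, (∑ z ∈ W, m x z * f z) ^ 2 / p x ≤
        ∑ y ∈ W, m x y * f y ^ 2 - γ / 2 * ∑ y ∈ W, m x y * (f x - f y) ^ 2 := by
      intro x hx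
      have hpx := hp x hx
      set a := (∑ z ∈ W, m x z * f z) with ha
      set b := ∑ y ∈ W, m x y * f y ^ 2 with hb
      set e := ∑ y ∈ W, m x y * (f x - f y) ^ 2 with he
      -- Variance identity for `f` after one step from `x`, whose mean is `a / p x`. Laziness enters
      -- in `h3` by keeping only the term `y = x`.
      have h1 : ∑ y ∈ W, m x y * (p x * f y - a) ^ 2 = p x ^ 2 * b - p x * a ^ 2 := by
        have : ∀ y, m x y * (p x * f y - a) ^ 2 =
            p x ^ 2 * (m x y * f y ^ 2) - 2 * p x * a * (m x y * f y) + a ^ 2 * m x y := by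
          intro y; ring
        simp only [this, Finset.sum_add_distrib, Finset.sum_sub_distrib, ← Finset.mul_sum]
        rw [← ha, ← hb, ← hpm x hx]; ring
      have h2 : e = p x * f x ^ 2 - 2 * f x * a + b := by
        have : ∀ y, m x y * (f x - f y) ^ 2 =
            f x ^ 2 * m x y - 2 * f x * (m x y * f y) + m x y * f y ^ 2 := by
          intro y; ring
        simp only [he, this, Finset.sum_add_distrib, Finset.sum_sub_distrib, ← Finset.mul_sum]
        rw [← ha, ← hb, ← hpm x hx]; ring
      have h3 : m x x * (p x * f x - a) ^ 2 ≤ p x ^ 2 * b - p x * a ^ 2 := by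
        rw [← h1]
        exact Finset.single_le_sum (f := fun y => m x y * (p x * f y - a) ^ 2)
          (fun y _ => mul_nonneg (hm x y) (sq_nonneg _)) hx
      have hmx := hlazy x hx
      have hmx2 : m x x ≤ p x := by
        rw [hpm x hx]
        exact Finset.single_le_sum (f := fun y => m x y) (fun y _ => hm x y) hx
      have hγ1 : γ ≤ 1 := by nlinarith
      have h4 : γ * (p x * f x - a) ^ 2 ≤ p x * b - a ^ 2 := by
        refine le_of_mul_le_mul_left ?_ hpx
        nlinarith [mul_le_mul_of_nonneg_right hmx (sq_nonneg (p x * f x - a))]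
      have h5 : 0 ≤ p x * b - a ^ 2 := le_trans (by positivity) h4
      -- The mean square of `f x - f y` is squared bias plus variance, and by `h4` the squared bias
      -- is at most the variance over `γ`.
      have h6 : γ / 2 * (p x * e) ≤ p x * b - a ^ 2 := by
        have : p x * e = (p x * f x - a) ^ 2 + (p x * b - a ^ 2) := by rw [h2]; ring
        rw [this]
        nlinarith
      rw [div_le_iff₀ hpx]
      linarith
    calc _ ≤ ∑ x ∈ W, (∑ y ∈ W, m x y * f y ^ 2 - γ / 2 * ∑ y ∈ W, m x y * (f x - f y) ^ 2) :=
          Finset.sum_le_sum hpt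
      _ = N - γ / 2 * E := by
          rw [Finset.sum_sub_distrib, ← Finset.mul_sum, Finset.sum_comm]
          congr 1
          refine Finset.sum_congr rfl fun x hx => ?_
          rw [hpm x hx, Finset.sum_mul]
          exact Finset.sum_congr rfl fun y _ => by rw [hsymm]
  refine ⟨by nlinarith, ?_⟩
  -- Since `f` is a probability density, Markov's inequality gives `{f > 2 / v}` volume at most `v /
  -- 2`, so Cheeger's inequality applies to the truncation `(f - a)⁺`.
  set a := 2 / v with ha
  have ha0 : 0 < a := by positivity
  set S := W.filter (fun x => a < f x) with hS
  set h : V → ℝ := fun x => if x ∈ S then f x - a else 0 with hh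
  have hSW : S ⊆ W := Finset.filter_subset _ _
  have hBS : ∑ x ∈ S, p x ≤ v / 2 := by
    have h1 : a * ∑ x ∈ S, p x ≤ 1 := by
      rw [← hf1, Finset.mul_sum]
      refine (Finset.sum_le_sum fun x hx => ?_).trans
        (Finset.sum_le_sum_of_subset_of_nonneg hSW
          (fun x hx _ => mul_nonneg (hp x hx).le (hf x)))
      have := (Finset.mem_filter.1 hx).2
      nlinarith [hp x (hSW hx)]
    rw [ha, div_mul_eq_mul_div, div_le_iff₀ hv] at h1
    linarith
  have hch := cheeger_inequality W m p Φ (v / 2) hsymm hm hpm hΦ0 hΦ S hSW hBS h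
    (fun x hx => by
      have := (Finset.mem_filter.1 hx).2
      simp only [hh, hx, if_true]; linarith)
    (fun x hx => by simp [hh, hx])
  have hval : ∀ x ∈ W, h x = max (f x - a) 0 := by
    intro x hx
    by_cases hxS : x ∈ S
    · have := (Finset.mem_filter.1 hxS).2
      simp only [hh, hxS, if_true]; rw [max_eq_left (by linarith)]
    · have : ¬ a < f x := fun h => hxS (Finset.mem_filter.2 ⟨hx, h⟩)
      simp only [hh, hxS, if_false]; rw [max_eq_right (by linarith)]
  have hEh : ∑ x ∈ W, ∑ y ∈ W, m x y * (h x - h y) ^ 2 ≤ E := by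
    refine Finset.sum_le_sum fun x hx => Finset.sum_le_sum fun y hy =>
      mul_le_mul_of_nonneg_left ?_ (hm x y)
    rw [hval x hx, hval y hy]
    refine sq_le_sq.2 ((abs_max_sub_max_le_abs _ _ _).trans (le_of_eq ?_))
    congr 1; ring
  have hNh : N ≤ ∑ x ∈ W, p x * h x ^ 2 + 4 / v := by
    have h4 : 4 / v = 2 * a * ∑ x ∈ W, p x * f x := by rw [hf1, ha]; ring
    rw [h4, Finset.mul_sum, ← Finset.sum_add_distrib]
    refine Finset.sum_le_sum fun x hx => ?_
    -- Truncation costs `2 * a` times the total mass 1, which is the `4 / v` of the statement.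
    have h5 : f x ^ 2 ≤ h x ^ 2 + 2 * a * f x := by
      have := hf x
      rw [hval x hx]
      rcases le_total (f x - a) 0 with h | h
      · rw [max_eq_right h]; nlinarith
      · rw [max_eq_left h]; nlinarith
    nlinarith [mul_le_mul_of_nonneg_left h5 (hp x hx).le]
  have hfin : Φ ^ 2 * (N - 4 / v) ≤ E :=
    (mul_le_mul_of_nonneg_left (by linarith) (sq_nonneg Φ)).trans (hch.trans hEh)
  nlinarith

/-! ### Volumes and the Cheeger constant. -/

namespace MultiGraph

variable {V : Type*}

theorem degree_eq_sum (G : MultiGraph V) (x : V) (W : Finset V)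
    (h : ∀ y, G.mult x y ≠ 0 → y ∈ W) : G.degree x = ∑ y ∈ W, G.mult x y :=
  finsum_eq_sum_of_support_subset _ fun y hy => h y hy

theorem mem_verts_of_mult_ne_zero (G : MultiGraph V) {x y : V} (hx : x ∈ G.verts)
    (h : G.mult x y ≠ 0) : y ∈ G.verts := by
  by_cases hxy : x = y
  · exact hxy ▸ hx
  · exact ⟨x, hxy, by rwa [G.symm]⟩

theorem volume_eq_sum (G : MultiGraph V) {A : Set V} (hA : A.Finite) :
    G.volume A = ∑ x ∈ hA.toFinset, (G.degree x : ℝ) :=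
  finsum_mem_eq_finite_toFinset_sum _ hA

theorem volume_coe_eq_sum (G : MultiGraph V) (A : Finset V) :
    G.volume (A : Set V) = ∑ x ∈ A, (G.degree x : ℝ) :=
  finsum_mem_coe_finset _ _

theorem volume_nonneg (G : MultiGraph V) (A : Set V) : 0 ≤ G.volume A :=
  finsum_nonneg fun _ => finsum_nonneg fun _ => Nat.cast_nonneg _

theorem volume_mono (G : MultiGraph V) {A B : Set V} (hB : B.Finite) (h : A ⊆ B) :
    G.volume A ≤ G.volume B := by
  rw [G.volume_eq_sum hB, G.volume_eq_sum (hB.subset h)]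
  exact Finset.sum_le_sum_of_subset_of_nonneg (by simpa using h) fun _ _ _ => Nat.cast_nonneg _

theorem edgeCount_coe_eq_sum (G : MultiGraph V) (A B : Finset V) :
    G.edgeCount (A : Set V) (B : Set V) = ∑ x ∈ A, ∑ y ∈ B, (G.mult x y : ℝ) := by
  unfold edgeCount
  rw [finsum_mem_coe_finset]
  exact Finset.sum_congr rfl fun x _ => finsum_mem_coe_finset _ _

theorem edgeCount_nonneg (G : MultiGraph V) (A B : Set V) : 0 ≤ G.edgeCount A B :=
  finsum_nonneg fun _ => finsum_nonneg fun _ => finsum_nonneg fun _ => finsum_nonneg fun _ =>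
    Nat.cast_nonneg _

theorem cheeger_nonneg (G : MultiGraph V) : 0 ≤ G.cheeger :=
  Real.sInf_nonneg fun _ ⟨_, _, _, _, h⟩ =>
    h ▸ div_nonneg (G.edgeCount_nonneg _ _) (G.volume_nonneg _)

theorem cheeger_le (G : MultiGraph V) {A : Set V} (hA : A ⊆ G.verts) (hne : A.Nonempty)
    (hv : G.volume A ≤ G.totalVolume / 2) :
    G.cheeger ≤ G.edgeCount A (G.verts \ A) / G.volume A := by
  refine csInf_le ⟨0, ?_⟩ ⟨A, hA, hne, hv, rfl⟩
  rintro _ ⟨_, _, _, _, rfl⟩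
  exact div_nonneg (G.edgeCount_nonneg _ _) (G.volume_nonneg _)

theorem step_nonneg (G : MultiGraph V) (x y : V) : 0 ≤ G.step x y :=
  div_nonneg (Nat.cast_nonneg _) (Nat.cast_nonneg _)

end MultiGraph

/-! ### Monotonicity in time, transition probabilities and the energy. -/

namespace GrowingGraph

variable {V : Type*}

theorem mult_mono (𝒢 : GrowingGraph V) {s t : ℕ} (h : s ≤ t) (x y : V) :
    (𝒢.graph s).mult x y ≤ (𝒢.graph t).mult x y :=
  monotone_nat_of_le_succ (f := fun t => (𝒢.graph t).mult x y) (fun t => 𝒢.mono t x y) h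

theorem verts_mono (𝒢 : GrowingGraph V) {s t : ℕ} (h : s ≤ t) : 𝒢.verts s ⊆ 𝒢.verts t := by
  rintro x ⟨y, hy, h0⟩
  have := 𝒢.mult_mono h x y
  exact ⟨y, hy, by omega⟩

/-- The vertex set at time `t` as a finset. -/
noncomputable def vertFinset (𝒢 : GrowingGraph V) (t : ℕ) : Finset V := (𝒢.finite_verts t).toFinset

@[simp]
theorem mem_vertFinset (𝒢 : GrowingGraph V) {t : ℕ} {x : V} :
    x ∈ 𝒢.vertFinset t ↔ x ∈ 𝒢.verts t :=
  Set.Finite.mem_toFinset _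

@[simp]
theorem coe_vertFinset (𝒢 : GrowingGraph V) (t : ℕ) : (𝒢.vertFinset t : Set V) = 𝒢.verts t :=
  Set.Finite.coe_toFinset _

theorem degree_mono (𝒢 : GrowingGraph V) {s t : ℕ} (h : s ≤ t) (x : V) :
    (𝒢.graph s).degree x ≤ (𝒢.graph t).degree x := by
  have hsub : ∀ u y, (𝒢.graph u).mult x y ≠ 0 → y ∈ (𝒢.locallyFinite x).toFinset := by
    intro u y hy
    have := 𝒢.le_limit u x y
    simp only [Set.Finite.mem_toFinset, Set.mem_ofPred_eq]
    omega
  rw [(𝒢.graph s).degree_eq_sum x _ (hsub s), (𝒢.graph t).degree_eq_sum x _ (hsub t)]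
  exact Finset.sum_le_sum fun y _ => 𝒢.mult_mono h x y

theorem degree_eq (𝒢 : GrowingGraph V) {t : ℕ} {x : V} (hx : x ∈ 𝒢.verts t) :
    (𝒢.graph t).degree x = ∑ y ∈ 𝒢.vertFinset t, (𝒢.graph t).mult x y :=
  (𝒢.graph t).degree_eq_sum x _ fun _ hy =>
    𝒢.mem_vertFinset.2 ((𝒢.graph t).mem_verts_of_mult_ne_zero hx hy)

theorem degree_pos (𝒢 : GrowingGraph V) {t : ℕ} {x : V} (hx : x ∈ 𝒢.verts t) :
    0 < (𝒢.graph t).degree x := by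
  rw [𝒢.degree_eq hx]
  obtain ⟨y, hy, h0⟩ := id hx
  exact Finset.sum_pos' (fun _ _ => Nat.zero_le _)
    ⟨y, 𝒢.mem_vertFinset.2 ((𝒢.graph t).mem_verts_of_mult_ne_zero hx h0), Nat.pos_of_ne_zero h0⟩

theorem vol_eq (𝒢 : GrowingGraph V) (t : ℕ) :
    𝒢.vol t = ∑ x ∈ 𝒢.vertFinset t, ((𝒢.graph t).degree x : ℝ) :=
  (𝒢.graph t).volume_eq_sum (𝒢.finite_verts t)

theorem vol_mono (𝒢 : GrowingGraph V) {s t : ℕ} (h : s ≤ t) : 𝒢.vol s ≤ 𝒢.vol t := by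
  rw [vol_eq, vol_eq]
  calc _ ≤ ∑ x ∈ 𝒢.vertFinset s, ((𝒢.graph t).degree x : ℝ) :=
        Finset.sum_le_sum fun x _ => Nat.cast_le.2 (𝒢.degree_mono h x)
    _ ≤ _ := Finset.sum_le_sum_of_subset_of_nonneg
        (fun x hx => 𝒢.mem_vertFinset.2 (𝒢.verts_mono h (𝒢.mem_vertFinset.1 hx)))
        fun _ _ _ => Nat.cast_nonneg _

theorem card_le_vol (𝒢 : GrowingGraph V) (t : ℕ) : ((𝒢.vertFinset t).card : ℝ) ≤ 𝒢.vol t := by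
  rw [vol_eq, Finset.card_eq_sum_ones, Nat.cast_sum]
  exact Finset.sum_le_sum fun x hx => Nat.cast_le.2 (𝒢.degree_pos (𝒢.mem_vertFinset.1 hx))

theorem vol_pos (𝒢 : GrowingGraph V) {t : ℕ} {x : V} (hx : x ∈ 𝒢.verts t) : 0 < 𝒢.vol t :=
  lt_of_lt_of_le (Nat.cast_pos.2 (Finset.card_pos.2 ⟨x, 𝒢.mem_vertFinset.2 hx⟩)) (𝒢.card_le_vol t)

theorem cheeger_mul_le (𝒢 : GrowingGraph V) [DecidableEq V] (t : ℕ) (S : Finset V)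
    (hS : S ⊆ 𝒢.vertFinset t) (hne : S.Nonempty)
    (hv : ∑ x ∈ S, ((𝒢.graph t).degree x : ℝ) ≤ 𝒢.vol t / 2) :
    (𝒢.graph t).cheeger * ∑ x ∈ S, ((𝒢.graph t).degree x : ℝ) ≤
      ∑ x ∈ S, ∑ y ∈ 𝒢.vertFinset t \ S, ((𝒢.graph t).mult x y : ℝ) := by
  have hS' : (S : Set V) ⊆ (𝒢.graph t).verts := fun x hx => 𝒢.mem_vertFinset.1 (hS hx)
  have h := (𝒢.graph t).cheeger_le hS' (by simpa using hne)
    (by rw [MultiGraph.volume_coe_eq_sum]; exact hv)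
  have hc : (𝒢.graph t).verts \ (S : Set V) = ((𝒢.vertFinset t \ S : Finset V) : Set V) := by
    rw [Finset.coe_sdiff, coe_vertFinset]; rfl
  rw [hc, MultiGraph.edgeCount_coe_eq_sum, MultiGraph.volume_coe_eq_sum] at h
  have hpos : 0 < ∑ x ∈ S, ((𝒢.graph t).degree x : ℝ) :=
    Finset.sum_pos (fun x hx => Nat.cast_pos.2 (𝒢.degree_pos (hS' hx))) hne
  exact (le_div_iff₀ hpos).1 h

theorem transProb_nonneg (𝒢 : GrowingGraph V) (x₀ : V) (t : ℕ) (y : V) :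
    0 ≤ 𝒢.transProb x₀ t y := by
  induction t generalizing y with
  | zero => simp only [transProb]; split_ifs <;> norm_num
  | succ t ih => exact finsum_nonneg fun z => mul_nonneg (ih z) (MultiGraph.step_nonneg _ _ _)

theorem mem_verts_of_transProb_ne_zero (𝒢 : GrowingGraph V) {x₀ : V} (h₀ : x₀ ∈ 𝒢.verts 0) {t : ℕ}
    {y : V} (h : 𝒢.transProb x₀ t y ≠ 0) : y ∈ 𝒢.verts t := by
  induction t generalizing y with
  | zero =>
    simp only [transProb] at h
    split_ifs at h with hy
    · exact hy ▸ h₀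
    · exact absurd rfl h
  | succ t ih =>
    obtain ⟨z, hz⟩ : ∃ z, 𝒢.transProb x₀ t z * (𝒢.graph t).step z y ≠ 0 := by
      by_contra! hall
      exact h (by rw [transProb, finsum_congr hall, finsum_zero])
    have hzv := ih (left_ne_zero_of_mul hz)
    refine 𝒢.verts_mono (Nat.le_succ t) ((𝒢.graph t).mem_verts_of_mult_ne_zero hzv (y := y) ?_)
    intro h0
    exact right_ne_zero_of_mul hz (by simp [MultiGraph.step, h0])

theorem transProb_succ (𝒢 : GrowingGraph V) {x₀ : V} (h₀ : x₀ ∈ 𝒢.verts 0) {t : ℕ} {W : Finset V}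
    (hW : 𝒢.verts t ⊆ W) (y : V) :
    𝒢.transProb x₀ (t + 1) y = ∑ z ∈ W, 𝒢.transProb x₀ t z * (𝒢.graph t).step z y := by
  refine finsum_eq_sum_of_support_subset _ fun z hz => ?_
  exact hW (𝒢.mem_verts_of_transProb_ne_zero h₀ (left_ne_zero_of_mul hz))

theorem transProb_mul_step_le (𝒢 : GrowingGraph V) {x₀ : V} (h₀ : x₀ ∈ 𝒢.verts 0) (t : ℕ)
    (S : Finset V) (y : V) :
    ∑ z ∈ S, 𝒢.transProb x₀ t z * (𝒢.graph t).step z y ≤ 𝒢.transProb x₀ (t + 1) y := by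
  classical
  rw [𝒢.transProb_succ h₀ (W := S ∪ 𝒢.vertFinset t) (by simp)]
  exact Finset.sum_le_sum_of_subset_of_nonneg Finset.subset_union_left
    fun z _ _ => mul_nonneg (𝒢.transProb_nonneg _ _ _) (MultiGraph.step_nonneg _ _ _)

/-- Staying put costs a factor `γ`. This absorbs the rounding of real times and keeps positive
probabilities positive. -/
theorem mul_transProb_le_succ (𝒢 : GrowingGraph V) {x₀ : V} (h₀ : x₀ ∈ 𝒢.verts 0) {γ : ℝ}
    (hlazy : 𝒢.Lazy γ) (t : ℕ) (y : V) :
    γ * 𝒢.transProb x₀ t y ≤ 𝒢.transProb x₀ (t + 1) y := by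
  by_cases hy : 𝒢.transProb x₀ t y = 0
  · rw [hy, mul_zero]; exact 𝒢.transProb_nonneg _ _ _
  · refine le_trans ?_ (𝒢.transProb_mul_step_le h₀ t {y} y)
    rw [Finset.sum_singleton, mul_comm]
    exact mul_le_mul_of_nonneg_left (hlazy t y (𝒢.mem_verts_of_transProb_ne_zero h₀ hy))
      (𝒢.transProb_nonneg _ _ _)

theorem transProb_pos_of_le (𝒢 : GrowingGraph V) {x₀ : V} (h₀ : x₀ ∈ 𝒢.verts 0) {γ : ℝ}
    (hγ : 0 < γ) (hlazy : 𝒢.Lazy γ) {s t : ℕ} (hst : s ≤ t) {y : V}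
    (h : 0 < 𝒢.transProb x₀ s y) : 0 < 𝒢.transProb x₀ t y := by
  induction t, hst using Nat.le_induction with
  | base => exact h
  | succ t _ ih => exact lt_of_lt_of_le (mul_pos hγ ih) (𝒢.mul_transProb_le_succ h₀ hlazy t y)

theorem sum_transProb (𝒢 : GrowingGraph V) {x₀ : V} (h₀ : x₀ ∈ 𝒢.verts 0) (t : ℕ) :
    ∑ y ∈ 𝒢.vertFinset t, 𝒢.transProb x₀ t y = 1 := by
  induction t with
  | zero =>
    simp only [transProb]
    rw [Finset.sum_eq_single_of_mem x₀ (𝒢.mem_vertFinset.2 h₀) fun y _ hy => if_neg hy, if_pos rfl]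
  | succ t ih =>
    rw [Finset.sum_congr rfl fun y _ =>
      𝒢.transProb_succ h₀ (W := 𝒢.vertFinset t) (by simp) y, Finset.sum_comm, ← ih]
    refine Finset.sum_congr rfl fun z hz => ?_
    have hz' := 𝒢.mem_vertFinset.1 hz
    rw [← Finset.mul_sum]
    simp only [MultiGraph.step, ← Finset.sum_div]
    have hsum : ∑ y ∈ 𝒢.vertFinset (t + 1), (𝒢.graph t).mult z y = (𝒢.graph t).degree z :=
      ((𝒢.graph t).degree_eq_sum z _ fun y hy => 𝒢.mem_vertFinset.2 (𝒢.verts_mono (Nat.le_succ t)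
        ((𝒢.graph t).mem_verts_of_mult_ne_zero hz' hy))).symm
    rw [← Nat.cast_sum, hsum, div_self (by exact_mod_cast (𝒢.degree_pos hz').ne'), mul_one]

/-- The squared `L²` norm, with respect to the vertex degrees, of the density of the walk at time
`t`. -/
noncomputable def energy (𝒢 : GrowingGraph V) (x₀ : V) (t : ℕ) : ℝ :=
  ∑ y ∈ 𝒢.vertFinset t, 𝒢.transProb x₀ t y ^ 2 / (𝒢.graph t).degree y

theorem energy_nonneg (𝒢 : GrowingGraph V) (x₀ : V) (t : ℕ) : 0 ≤ 𝒢.energy x₀ t :=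
  Finset.sum_nonneg fun _ _ => div_nonneg (sq_nonneg _) (Nat.cast_nonneg _)

theorem energy_zero_le (𝒢 : GrowingGraph V) {x₀ : V} (h₀ : x₀ ∈ 𝒢.verts 0) :
    𝒢.energy x₀ 0 ≤ 1 := by
  rw [← 𝒢.sum_transProb h₀ 0]
  refine Finset.sum_le_sum fun y hy => ?_
  have h1 : (1 : ℝ) ≤ (𝒢.graph 0).degree y := by
    exact_mod_cast 𝒢.degree_pos (𝒢.mem_vertFinset.1 hy)
  have h2 : 𝒢.transProb x₀ 0 y ^ 2 = 𝒢.transProb x₀ 0 y := by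
    simp only [transProb]; split_ifs <;> norm_num
  rw [h2]
  exact div_le_self (𝒢.transProb_nonneg _ _ _) h1

/-- The contraction is that of a walk step on the fixed graph at time `t`. Passing to the next graph
only enlarges the denominators, and vertices that are new at time `t + 1` carry no mass yet. -/
theorem energy_succ_le (𝒢 : GrowingGraph V) {x₀ : V} (h₀ : x₀ ∈ 𝒢.verts 0) {γ : ℝ} (hγ : 0 < γ)
    (hlazy : 𝒢.Lazy γ) (t : ℕ) :
    𝒢.energy x₀ (t + 1) ≤ 𝒢.energy x₀ t ∧
    𝒢.energy x₀ (t + 1) ≤ 𝒢.energy x₀ t -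
      γ / 2 * (𝒢.graph t).cheeger ^ 2 * (𝒢.energy x₀ t - 4 / 𝒢.vol t) := by
  classical
  set W := 𝒢.vertFinset t with hW
  set p : V → ℝ := fun x => (𝒢.graph t).degree x with hp
  set m : V → V → ℝ := fun x y => (𝒢.graph t).mult x y with hm
  set f : V → ℝ := fun x => 𝒢.transProb x₀ t x / p x with hf
  have hppos : ∀ x ∈ W, 0 < p x := fun x hx =>
    Nat.cast_pos.2 (𝒢.degree_pos (𝒢.mem_vertFinset.1 hx))
  have hE : ∑ x ∈ W, p x * f x ^ 2 = 𝒢.energy x₀ t := by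
    refine Finset.sum_congr rfl fun x hx => ?_
    have := (hppos x hx).ne'
    simp only [hf]
    change _ = 𝒢.transProb x₀ t x ^ 2 / p x
    field_simp
  have hnext : ∀ y, 𝒢.transProb x₀ (t + 1) y = ∑ z ∈ W, m y z * f z := by
    intro y
    rw [𝒢.transProb_succ h₀ (W := W) (by simp [hW])]
    refine Finset.sum_congr rfl fun z _ => ?_
    simp only [MultiGraph.step, hm, hf, hp, (𝒢.graph t).symm y z]
    ring
  have hE' : 𝒢.energy x₀ (t + 1) ≤ ∑ y ∈ W, (∑ z ∈ W, m y z * f z) ^ 2 / p y := by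
    simp only [← hnext]
    have hsub : W ⊆ 𝒢.vertFinset (t + 1) := fun x hx =>
      𝒢.mem_vertFinset.2 (𝒢.verts_mono (Nat.le_succ t) (𝒢.mem_vertFinset.1 hx))
    unfold energy
    rw [← Finset.sum_subset hsub]
    · refine Finset.sum_le_sum fun x hx => ?_
      exact div_le_div_of_nonneg_left (sq_nonneg _) (hppos x hx)
        (Nat.cast_le.2 (𝒢.degree_mono (Nat.le_succ t) x))
    · intro x _ hx
      have : 𝒢.transProb x₀ (t + 1) x = 0 := by
        rw [hnext]
        refine Finset.sum_eq_zero fun z hz => ?_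
        have : m x z = 0 := by
          by_contra h
          refine hx (𝒢.mem_vertFinset.2 ((𝒢.graph t).mem_verts_of_mult_ne_zero
            (𝒢.mem_vertFinset.1 hz) (y := x) ?_))
          rw [(𝒢.graph t).symm]
          exact fun h' => h (by simp [hm, h'])
        rw [this, zero_mul]
      simp [this]
  obtain ⟨h1, h2⟩ := lazy_step_sq_le W m p (𝒢.graph t).cheeger γ (𝒢.vol t)
    (fun x y => by simp only [hm, (𝒢.graph t).symm x y]) (fun x y => Nat.cast_nonneg _)
    (fun x hx => by
      simp only [hp, hm]
      rw [𝒢.degree_eq (𝒢.mem_vertFinset.1 hx), Nat.cast_sum])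
    hppos (MultiGraph.cheeger_nonneg _) (𝒢.vol_pos (𝒢.verts_mono (Nat.zero_le t) h₀)) hγ
    (fun x hx => by
      have := hlazy t x (𝒢.mem_vertFinset.1 hx)
      exact (le_div_iff₀ (hppos x hx)).1 this)
    (fun S hS hne hv => 𝒢.cheeger_mul_le t S hS hne hv) f
    (fun x => div_nonneg (𝒢.transProb_nonneg _ _ _) (Nat.cast_nonneg _))
    (by
      rw [← 𝒢.sum_transProb h₀ t]
      refine Finset.sum_congr rfl fun x hx => ?_
      have := (hppos x hx).ne'
      simp only [hf]; field_simp)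
  rw [hE] at h1 h2
  exact ⟨hE'.trans h1, hE'.trans h2⟩

end GrowingGraph

/-! ### Decay of the energy at the rate of the inverse volume. -/

namespace GrowingGraph

variable {V : Type*}

theorem energy_antitone (𝒢 : GrowingGraph V) {x₀ : V} (h₀ : x₀ ∈ 𝒢.verts 0) {γ : ℝ} (hγ : 0 < γ)
    (hlazy : 𝒢.Lazy γ) : Antitone (𝒢.energy x₀) :=
  antitone_nat_of_succ_le fun t => (𝒢.energy_succ_le h₀ hγ hlazy t).1

/-- Discrete Gronwall argument for the excess over the fixed level `4 / v(s)`, which dominates every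
later `4 / v(u)`. -/
theorem energy_le_exp (𝒢 : GrowingGraph V) {x₀ : V} (h₀ : x₀ ∈ 𝒢.verts 0) {γ : ℝ} (hγ : 0 < γ)
    (hlazy : 𝒢.Lazy γ) {s t : ℕ} (hst : s ≤ t) :
    𝒢.energy x₀ t ≤ Real.exp (-(γ / 2 * ∑ u ∈ Finset.Ico s t, (𝒢.graph u).cheeger ^ 2)) +
      4 / 𝒢.vol s := by
  have hs : 0 < 𝒢.vol s := 𝒢.vol_pos (𝒢.verts_mono (Nat.zero_le s) h₀)
  induction t, hst using Nat.le_induction with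
  | base =>
    have h1 : 𝒢.energy x₀ s ≤ 1 :=
      (𝒢.energy_antitone h₀ hγ hlazy (Nat.zero_le s)).trans (𝒢.energy_zero_le h₀)
    have : 0 < 4 / 𝒢.vol s := by positivity
    simp; linarith
  | succ t hst ih =>
    obtain ⟨h1, h2⟩ := 𝒢.energy_succ_le h₀ hγ hlazy t
    have hK : 4 / 𝒢.vol t ≤ 4 / 𝒢.vol s :=
      div_le_div_of_nonneg_left (by norm_num) hs (𝒢.vol_mono hst)
    rw [Finset.sum_Ico_succ_top hst, mul_add, neg_add, Real.exp_add]
    set K := 4 / 𝒢.vol s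
    set q := γ / 2 * (𝒢.graph t).cheeger ^ 2 with hq
    have hq0 : 0 ≤ q := by positivity
    set e := Real.exp (-(γ / 2 * ∑ u ∈ Finset.Ico s t, (𝒢.graph u).cheeger ^ 2))
    have he : 0 < e := Real.exp_pos _
    have hexp : 1 - q ≤ Real.exp (-q) := Real.one_sub_le_exp_neg q
    -- Below the level `K`, monotonicity suffices; above it, the excess contracts by `1 - q ≤ exp
    -- (-q)`.
    rcases le_total (𝒢.energy x₀ t) K with h | h
    · have : 0 ≤ e * Real.exp (-q) := by positivity
      linarith
    · have h3 : 𝒢.energy x₀ (t + 1) - K ≤ (1 - q) * (𝒢.energy x₀ t - K) := by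
        nlinarith
      have h4 : (1 - q) * (𝒢.energy x₀ t - K) ≤ Real.exp (-q) * (𝒢.energy x₀ t - K) :=
        mul_le_mul_of_nonneg_right hexp (by linarith)
      have h5 : Real.exp (-q) * (𝒢.energy x₀ t - K) ≤ Real.exp (-q) * e :=
        mul_le_mul_of_nonneg_left (by linarith) (Real.exp_pos _).le
      linarith

theorem exists_mem_verts (𝒢 : GrowingGraph V) [Infinite V] (x : V) : ∃ t, x ∈ 𝒢.verts t := by
  obtain ⟨y, hy⟩ := 𝒢.limit_connected.preconnected.exists_adj_of_nontrivial x
  obtain ⟨t, ht⟩ := 𝒢.exhausts x y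
  exact ⟨t, y, hy.1.symm, by rw [ht]; exact hy.2⟩

theorem eventually_subset_verts (𝒢 : GrowingGraph V) [Infinite V] (S : Finset V) :
    ∀ᶠ t in Filter.atTop, (S : Set V) ⊆ 𝒢.verts t := by
  have : ∀ x ∈ S, ∀ᶠ t in Filter.atTop, x ∈ 𝒢.verts t := fun x _ => by
    obtain ⟨t, ht⟩ := 𝒢.exists_mem_verts x
    exact Filter.eventually_atTop.2 ⟨t, fun s hs => 𝒢.verts_mono hs ht⟩
  filter_upwards [(Filter.eventually_all_finset S).2 this] with t ht x hx
  exact ht x hx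

theorem tendsto_vol (𝒢 : GrowingGraph V) [Infinite V] :
    Filter.Tendsto 𝒢.vol Filter.atTop Filter.atTop := by
  refine Filter.tendsto_atTop.2 fun b => ?_
  obtain ⟨S, hS⟩ := Infinite.exists_subset_card_eq V ⌈b⌉₊
  filter_upwards [𝒢.eventually_subset_verts S] with t ht
  have hsub : S ⊆ 𝒢.vertFinset t := fun x hx => 𝒢.mem_vertFinset.2 (ht hx)
  calc b ≤ ⌈b⌉₊ := Nat.le_ceil b
    _ = S.card := by rw [hS]
    _ ≤ (𝒢.vertFinset t).card := Nat.cast_le.2 (Finset.card_le_card hsub)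
    _ ≤ 𝒢.vol t := 𝒢.card_le_vol t

theorem Regular.eventually_le (𝒢 : GrowingGraph V) [Infinite V] {ζ : ℝ} (hζ : 0 < ζ)
    (hreg : 𝒢.Regular ζ) : ∀ᶠ t : ℕ in Filter.atTop, 1 ≤ 𝒢.vol (t / 2) ∧
      ζ / 2 * Real.log (𝒢.vol (t / 2)) ≤
        ∑ u ∈ Finset.Ico (t / 2) t, (𝒢.graph u).cheeger ^ 2 := by
  have h1 : ((ζ / 2 : ℝ) : EReal) < Filter.liminf (fun t : ℕ =>
    (((∑ u ∈ Finset.Ico (t / 2) t, (𝒢.graph u).cheeger ^ 2) / Real.log (𝒢.vol (t / 2)) : ℝ) :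
      EReal)) Filter.atTop :=
    lt_of_lt_of_le (EReal.coe_lt_coe_iff.2 (by linarith)) hreg
  have hhalf : Filter.Tendsto (fun t : ℕ => t / 2) Filter.atTop Filter.atTop :=
    Nat.tendsto_div_const_atTop (by norm_num)
  filter_upwards [Filter.eventually_lt_of_lt_liminf h1,
    (𝒢.tendsto_vol.comp hhalf).eventually_gt_atTop 1] with t ht hv
  have hv' : 1 < 𝒢.vol (t / 2) := hv
  exact ⟨hv'.le, ((lt_div_iff₀ (Real.log_pos hv')).1 (EReal.coe_lt_coe_iff.1 ht)).le⟩

/-- On-diagonal decay: the squared `L²` norm of the density is of the order of the inverse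
volume. -/
theorem eventually_energy_le {γ ζ D₂ : ℝ} (hγ : 0 < γ) (hζ : 0 < ζ) :
    ∃ C : ℝ, 0 < C ∧ ∀ (V : Type*) [Infinite V] (𝒢 : GrowingGraph V) (x₀ : V), x₀ ∈ 𝒢.verts 0 →
      𝒢.Lazy γ → 𝒢.Regular ζ → 𝒢.VolDoubling D₂ →
        ∀ᶠ t : ℕ in Filter.atTop, 𝒢.energy x₀ t ≤ C / 𝒢.vol t := by
  set D := max D₂ 1 with hD
  have hD1 : 1 ≤ D := le_max_right _ _
  -- A single block `[t/2, t)` contributes only the exponent `γ * ζ / 4` of `1 / v`; `k` blocks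
  -- bring it to at least 1.
  set k := ⌈4 / (γ * ζ)⌉₊ with hk
  refine ⟨5 * (D ^ 2) ^ k, by positivity, fun V _ 𝒢 x₀ h₀ hlazy hreg hdoub => ?_⟩
  have hpos : ∀ t, 0 < 𝒢.vol t := fun t => 𝒢.vol_pos (𝒢.verts_mono (Nat.zero_le t) h₀)
  -- Two doublings, since `2 * (t / 2) < t` for odd `t`.
  have hhalf : ∀ t, 1 ≤ t / 2 → 𝒢.vol t ≤ D ^ 2 * 𝒢.vol (t / 2) := by
    intro t ht
    have hstep : ∀ u, 1 ≤ u → 𝒢.vol (2 * u) ≤ D * 𝒢.vol u := fun u hu =>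
      (hdoub u hu).trans (mul_le_mul_of_nonneg_right (le_max_left _ _) (hpos u).le)
    calc 𝒢.vol t ≤ 𝒢.vol (2 * (2 * (t / 2))) := 𝒢.vol_mono (by omega)
      _ ≤ D * 𝒢.vol (2 * (t / 2)) := hstep _ (by omega)
      _ ≤ D * (D * 𝒢.vol (t / 2)) := mul_le_mul_of_nonneg_left (hstep _ ht) (by positivity)
      _ = _ := by ring
  obtain ⟨T, hT⟩ := Filter.eventually_atTop.1 (hreg.eventually_le 𝒢 hζ)
  -- The sums over the `j` blocks are all compared with the logarithm of the smallest volume, that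
  -- of the earliest time.
  have hiter : ∀ j : ℕ, ∀ s : ℕ, T + 1 ≤ s / 2 ^ j →
      ζ / 2 * j * Real.log (𝒢.vol (s / 2 ^ j)) ≤
        ∑ u ∈ Finset.Ico (s / 2 ^ j) s, (𝒢.graph u).cheeger ^ 2 ∧
      𝒢.vol s ≤ (D ^ 2) ^ j * 𝒢.vol (s / 2 ^ j) := by
    intro j
    induction j with
    | zero => intro s _; simp
    | succ j ih =>
      intro s hs
      have hdiv : s / 2 ^ (j + 1) = s / 2 ^ j / 2 := by rw [pow_succ, Nat.div_div_eq_div_mul]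
      rw [hdiv] at hs ⊢
      obtain ⟨h1, h2⟩ := ih s (by omega)
      obtain ⟨h3, h4⟩ := hT (s / 2 ^ j) (by omega)
      set w := s / 2 ^ j with hw
      have hws : w ≤ s := Nat.div_le_self _ _
      constructor
      · rw [← Finset.sum_Ico_consecutive _ (Nat.div_le_self w 2) hws]
        have hlog : Real.log (𝒢.vol (w / 2)) ≤ Real.log (𝒢.vol w) :=
          Real.log_le_log (hpos _) (𝒢.vol_mono (Nat.div_le_self w 2))
        have : ζ / 2 * j * Real.log (𝒢.vol (w / 2)) ≤ ζ / 2 * j * Real.log (𝒢.vol w) :=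
          mul_le_mul_of_nonneg_left hlog (by positivity)
        push_cast
        linarith
      · calc 𝒢.vol s ≤ (D ^ 2) ^ j * 𝒢.vol w := h2
          _ ≤ (D ^ 2) ^ j * (D ^ 2 * 𝒢.vol (w / 2)) :=
            mul_le_mul_of_nonneg_left (hhalf w (by omega)) (by positivity)
          _ = _ := by ring
  have htend : Filter.Tendsto (fun t : ℕ => t / 2 ^ k) Filter.atTop Filter.atTop :=
    Nat.tendsto_div_const_atTop (by positivity)
  filter_upwards [htend.eventually_ge_atTop (T + 1),
    (𝒢.tendsto_vol.comp htend).eventually_ge_atTop 1] with s hs hv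
  obtain ⟨h1, h2⟩ := hiter k s hs
  have hE := 𝒢.energy_le_exp h₀ hγ hlazy (Nat.div_le_self s (2 ^ k))
  set w := s / 2 ^ k with hw
  have hv' : 1 ≤ 𝒢.vol w := hv
  have hlog : 0 ≤ Real.log (𝒢.vol w) := Real.log_nonneg hv'
  have hkge : 1 ≤ γ / 2 * (ζ / 2 * k) := by
    have := Nat.le_ceil (4 / (γ * ζ))
    rw [← hk, div_le_iff₀ (by positivity)] at this
    linarith
  have hexp : Real.exp (-(γ / 2 * ∑ u ∈ Finset.Ico w s, (𝒢.graph u).cheeger ^ 2)) ≤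
      1 / 𝒢.vol w := by
    rw [one_div, ← Real.exp_log (inv_pos.2 (hpos w)), Real.log_inv]
    refine Real.exp_le_exp.2 (neg_le_neg ?_)
    have h3 := mul_le_mul_of_nonneg_left h1 (by positivity : (0 : ℝ) ≤ γ / 2)
    nlinarith
  calc 𝒢.energy x₀ s ≤ 1 / 𝒢.vol w + 4 / 𝒢.vol w := hE.trans (by linarith)
    _ = 5 / 𝒢.vol w := by ring
    _ ≤ 5 * (D ^ 2) ^ k / 𝒢.vol s := by
      rw [div_le_div_iff₀ (hpos w) (hpos s)]
      nlinarith

end GrowingGraph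

/-! ### Volume doubling and thin annuli. -/

namespace MultiGraph

variable {V : Type*}

theorem mem_ball {G : MultiGraph V} {x y : V} {R : ℝ} :
    y ∈ G.ball x R ↔ (G.toSimple.dist x y : ℝ) ≤ R := Iff.rfl

theorem mem_ball_natCast {G : MultiGraph V} {x y : V} {n : ℕ} :
    y ∈ G.ball x n ↔ G.toSimple.dist x y ≤ n := by
  rw [mem_ball, Nat.cast_le]

theorem ball_mono (G : MultiGraph V) (x : V) {R S : ℝ} (h : R ≤ S) : G.ball x R ⊆ G.ball x S :=
  fun _ hy => le_trans hy h

theorem ball_floor (G : MultiGraph V) (x : V) {R : ℝ} (hR : 0 ≤ R) :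
    G.ball x (⌊R⌋₊ : ℝ) = G.ball x R := by
  ext y
  rw [mem_ball_natCast, mem_ball, Nat.le_floor_iff hR]

theorem dist_le_succ_of_mult_ne_zero (G : MultiGraph V) (hG : G.toSimple.Connected) (x : V)
    {y z : V} (h : G.mult y z ≠ 0) : G.toSimple.dist x z ≤ G.toSimple.dist x y + 1 := by
  by_cases hyz : y = z
  · subst hyz; omega
  · have hadj : G.toSimple.Adj y z := ⟨hyz, h⟩
    have h1 := SimpleGraph.dist_eq_one_iff_adj.2 hadj
    have h2 := hG.dist_triangle (u := x) (v := y) (w := z)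
    omega

theorem exists_dist_eq (G : MultiGraph V) (hG : G.toSimple.Connected) (x y : V) {k : ℕ}
    (hk : k ≤ G.toSimple.dist x y) :
    ∃ z, G.toSimple.dist x z + k = G.toSimple.dist x y ∧ G.toSimple.dist z y = k := by
  obtain ⟨p, hp⟩ := hG.exists_walk_length_eq_dist x y
  set L := G.toSimple.dist x y with hL
  refine ⟨p.getVert (L - k), ?_⟩
  have h1 : G.toSimple.dist x (p.getVert (L - k)) ≤ L - k := by
    refine (SimpleGraph.dist_le (p.take (L - k))).trans ?_
    rw [SimpleGraph.Walk.take_length]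
    exact min_le_left _ _
  have h2 : G.toSimple.dist (p.getVert (L - k)) y ≤ k := by
    refine (SimpleGraph.dist_le (p.drop (L - k))).trans ?_
    rw [SimpleGraph.Walk.drop_length]
    omega
  have h3 := hG.dist_triangle (u := x) (v := p.getVert (L - k)) (w := y)
  omega

theorem VolumeDoubling.mono {G : MultiGraph V} {D D' : ℝ} (h : G.VolumeDoubling D) (hD : D ≤ D') :
    G.VolumeDoubling D' := fun x R hR =>
  (h x R hR).trans (mul_le_mul_of_nonneg_right hD (G.volume_nonneg _))

theorem volume_ball_sub (G : MultiGraph V) [DecidableEq V] (hfin : ∀ x R, (G.ball x R).Finite)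
    (x : V) {R S : ℝ} (h : R ≤ S) :
    G.volume (G.ball x S) - G.volume (G.ball x R) =
      ∑ y ∈ (hfin x S).toFinset \ (hfin x R).toFinset, (G.degree y : ℝ) := by
  rw [G.volume_eq_sum (hfin x S), G.volume_eq_sum (hfin x R), ← Finset.sum_sdiff
    (show (hfin x R).toFinset ⊆ (hfin x S).toFinset by simpa using G.ball_mono x h)]
  ring

/-- Under volume doubling, the volume of an annulus is controlled by that of the adjacent inner
annulus of three times the width. -/
theorem volume_annulus_le (G : MultiGraph V) (hG : G.toSimple.Connected)
    (hfin : ∀ x R, (G.ball x R).Finite) (hdeg : ∀ x, 0 < G.degree x) {D : ℝ} (hD1 : 1 ≤ D)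
    (hD : G.VolumeDoubling D) (x₀ : V) {n h : ℕ} (hh : 1 ≤ h) (hn : 4 * h ≤ n) :
    G.volume (G.ball x₀ n) - G.volume (G.ball x₀ (n - h : ℕ)) ≤
      D ^ 2 * (G.volume (G.ball x₀ (n - h : ℕ)) - G.volume (G.ball x₀ (n - 4 * h : ℕ))) := by
  classical
  have hdist : ∀ x y, G.toSimple.dist x y = G.toSimple.dist y x := fun x y =>
    SimpleGraph.dist_comm
  rw [G.volume_ball_sub hfin x₀ (Nat.cast_le.2 (by omega)),
    G.volume_ball_sub hfin x₀ (Nat.cast_le.2 (by omega))]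
  set A := (hfin x₀ n).toFinset \ (hfin x₀ (n - h : ℕ)).toFinset with hA
  set A' := (hfin x₀ (n - h : ℕ)).toFinset \ (hfin x₀ (n - 4 * h : ℕ)).toFinset with hA'
  have hmA : ∀ x, x ∈ A ↔ G.toSimple.dist x₀ x ≤ n ∧ n - h < G.toSimple.dist x₀ x := by
    intro x; simp only [hA, Finset.mem_sdiff, Set.Finite.mem_toFinset, mem_ball_natCast, not_le]
  have hmA' : ∀ x, x ∈ A' ↔
      G.toSimple.dist x₀ x ≤ n - h ∧ n - 4 * h < G.toSimple.dist x₀ x := by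
    intro x; simp only [hA', Finset.mem_sdiff, Set.Finite.mem_toFinset, mem_ball_natCast, not_le]
  set vb : V → ℝ := fun w => G.volume (G.ball w (3 * h : ℕ)) with hvb
  have hvpos : ∀ w (R : ℕ), 0 < G.volume (G.ball w R) := by
    intro w R
    rw [G.volume_eq_sum (hfin w R)]
    refine Finset.sum_pos (fun x _ => Nat.cast_pos.2 (hdeg x)) ⟨w, ?_⟩
    simp only [Set.Finite.mem_toFinset, mem_ball_natCast, SimpleGraph.dist_self, Nat.zero_le]
  -- Averaging in place of a covering: go back `2 * h` along a geodesic from `x` to a point `z`.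
  -- Then `B(z, h)` lies in `A'`, and each of its points `w` has `B(w, 3h) ⊆ B(z, 4h)`, of volume at
  -- most `D ^ 2` times that of `B(z, h)`.
  have hpt : ∀ x ∈ A, (G.degree x : ℝ) ≤
      ∑ w ∈ A', if G.toSimple.dist w x ≤ 3 * h then
        D ^ 2 * ((G.degree x : ℝ) * G.degree w / vb w) else 0 := by
    intro x hx
    rw [hmA] at hx
    obtain ⟨z, hz1, hz2⟩ := G.exists_dist_eq hG x₀ x (k := 2 * h) (by omega)
    have hz : ∀ w ∈ (hfin z h).toFinset, G.toSimple.dist z w ≤ h := by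
      intro w hw
      simpa only [Set.Finite.mem_toFinset, mem_ball_natCast] using hw
    have hsub : (hfin z h).toFinset ⊆ A' := by
      intro w hw
      have h1 := hz w hw
      have h2 := hG.dist_triangle (u := x₀) (v := z) (w := w)
      have h3 := hG.dist_triangle (u := x₀) (v := w) (w := z)
      rw [hdist w z] at h3
      rw [hmA']
      omega
    have hvz := hvpos z h
    calc (G.degree x : ℝ) = ∑ w ∈ (hfin z h).toFinset,
          (G.degree x : ℝ) * G.degree w / G.volume (G.ball z h) := by
          rw [← Finset.sum_div, ← Finset.mul_sum, ← G.volume_eq_sum (hfin z h)]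
          field_simp
      _ ≤ ∑ w ∈ (hfin z h).toFinset, if G.toSimple.dist w x ≤ 3 * h then
            D ^ 2 * ((G.degree x : ℝ) * G.degree w / vb w) else 0 := by
          refine Finset.sum_le_sum fun w hw => ?_
          have h1 := hz w hw
          have h2 := hG.dist_triangle (u := w) (v := z) (w := x)
          rw [hdist w z] at h2
          rw [if_pos (by omega)]
          have h3 : vb w ≤ D ^ 2 * G.volume (G.ball z h) := by
            calc vb w ≤ G.volume (G.ball z (4 * h : ℕ)) := by
                  refine G.volume_mono (hfin _ _) fun u hu => ?_
                  rw [mem_ball_natCast] at hu ⊢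
                  have := hG.dist_triangle (u := z) (v := w) (w := u)
                  omega
              _ = G.volume (G.ball z (2 * (2 * h))) := by push_cast; congr 2; ring
              _ ≤ D * (D * G.volume (G.ball z h)) := by
                  have hh' : (0 : ℝ) < h := by exact_mod_cast hh
                  exact (hD z _ (by positivity)).trans
                    (mul_le_mul_of_nonneg_left (hD z _ hh') (by linarith))
              _ = _ := by ring
          have h4 := hvpos w (3 * h)
          rw [← mul_div_assoc, div_le_div_iff₀ hvz h4]
          have h5 : (0 : ℝ) ≤ (G.degree x : ℝ) * G.degree w := by positivity
          calc _ ≤ (G.degree x : ℝ) * G.degree w * (D ^ 2 * G.volume (G.ball z h)) :=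
                mul_le_mul_of_nonneg_left h3 h5
            _ = _ := by ring
      _ ≤ _ := by
          refine Finset.sum_le_sum_of_subset_of_nonneg hsub fun w _ _ => ?_
          split_ifs
          · have := hvpos w (3 * h)
            positivity
          · exact le_rfl
  refine (Finset.sum_le_sum hpt).trans ?_
  -- For fixed `w`, the points `x` involved lie in `B(w, 3h)`, which cancels the denominator `vb w`.
  rw [Finset.sum_comm, Finset.mul_sum]
  refine Finset.sum_le_sum fun w _ => ?_
  have hw := hvpos w (3 * h)
  rw [← Finset.sum_filter, ← Finset.mul_sum, ← Finset.sum_div, ← Finset.sum_mul]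
  refine mul_le_mul_of_nonneg_left ?_ (by positivity)
  rw [div_le_iff₀ hw, mul_comm]
  refine mul_le_mul_of_nonneg_left ?_ (Nat.cast_nonneg _)
  rw [G.volume_eq_sum (hfin w _)]
  refine Finset.sum_le_sum_of_subset_of_nonneg (fun x hx => ?_) fun _ _ _ => Nat.cast_nonneg _
  simpa only [Set.Finite.mem_toFinset, mem_ball_natCast] using (Finset.mem_filter.1 hx).2

/-- Each quadrupling of the width adds an inner annulus with at least the share `D⁻²` of the current
volume, so the volume grows geometrically in `j`. -/
theorem volume_annulus_pow_le (G : MultiGraph V) (hG : G.toSimple.Connected)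
    (hfin : ∀ x R, (G.ball x R).Finite) (hdeg : ∀ x, 0 < G.degree x) {D : ℝ} (hD1 : 1 ≤ D)
    (hD : G.VolumeDoubling D) (x₀ : V) {n h : ℕ} (hh : 1 ≤ h) (j : ℕ) (hn : 4 ^ j * h ≤ n) :
    (1 + (D ^ 2)⁻¹) ^ j * (G.volume (G.ball x₀ n) - G.volume (G.ball x₀ (n - h : ℕ))) ≤
      G.volume (G.ball x₀ n) - G.volume (G.ball x₀ (n - 4 ^ j * h : ℕ)) := by
  induction j with
  | zero => simp
  | succ j ih =>
    have hn' : 4 * (4 ^ j * h) ≤ n := by rw [← mul_assoc, mul_comm 4, ← pow_succ]; exact hn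
    have h1 := ih (by omega)
    have h2 := G.volume_annulus_le hG hfin hdeg hD1 hD x₀ (h := 4 ^ j * h)
      (Nat.mul_pos (by positivity) hh) hn'
    have h3 : 4 ^ (j + 1) * h = 4 * (4 ^ j * h) := by ring
    rw [h3, pow_succ]
    have hD0 : 0 < D ^ 2 := by positivity
    have h4 : (D ^ 2)⁻¹ * (G.volume (G.ball x₀ n) - G.volume (G.ball x₀ (n - 4 ^ j * h : ℕ))) ≤
        G.volume (G.ball x₀ (n - 4 ^ j * h : ℕ)) -
          G.volume (G.ball x₀ (n - 4 * (4 ^ j * h) : ℕ)) := by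
      rw [inv_mul_le_iff₀ hD0]; exact h2
    have h5 := mul_le_mul_of_nonneg_left h1 (by positivity : (0 : ℝ) ≤ 1 + (D ^ 2)⁻¹)
    linarith

/-- Under volume doubling, thin annuli have a small share of the volume of a large ball. -/
theorem exists_volume_ball_ge (D ε : ℝ) (hε : 0 < ε) :
    ∃ δ R₀ : ℝ, 0 < δ ∧ δ ≤ 1 / 4 ∧ ∀ (V : Type*) (G : MultiGraph V),
      G.toSimple.Connected → (∀ x R, (G.ball x R).Finite) → (∀ x, 0 < G.degree x) →
      G.VolumeDoubling D → ∀ (x₀ : V) (R : ℝ), R₀ ≤ R →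
        (1 - ε) * G.volume (G.ball x₀ R) ≤ G.volume (G.ball x₀ ((1 - δ) ^ 2 * R)) := by
  set D' := max D 1 with hD'
  have hD1 : 1 ≤ D' := le_max_right _ _
  have hκ : 0 < (D' ^ 2)⁻¹ := by positivity
  obtain ⟨k, hk⟩ := pow_unbounded_of_one_lt (1 / ε) (by linarith : 1 < 1 + (D' ^ 2)⁻¹)
  have h4 : (1 : ℝ) ≤ 4 ^ k := one_le_pow₀ (by norm_num)
  -- With `a = 4⁻ᵏ` and `δ = a / 4`, `(1 - δ) ^ 2 ≥ 1 - a / 2`. The removed width `h` is about `a *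
  -- R`, and `R ≥ 2 * 4 ^ k` makes the rounding error 1 at most `a * R / 2`.
  refine ⟨1 / (4 * 4 ^ k), 2 * 4 ^ k, by positivity, ?_, fun V G hG hfin hdeg hD x₀ R hR => ?_⟩
  · exact one_div_le_one_div_of_le (by norm_num) (by linarith)
  have hR0 : 0 ≤ R := by linarith
  set n := ⌊R⌋₊ with hn
  set h := n / 4 ^ k with hh
  have hnk : 4 ^ k ≤ n := by
    refine Nat.le_floor ?_
    push_cast; linarith
  have hle : 4 ^ k * h ≤ n := Nat.mul_div_le _ _
  have key := G.volume_annulus_pow_le hG hfin hdeg hD1 (hD.mono (le_max_left _ _)) x₀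
    (Nat.div_pos hnk (by positivity)) k hle
  rw [← hh, hn, G.ball_floor x₀ hR0, ← hn] at key
  set v := G.volume (G.ball x₀ R) with hv
  set v' := G.volume (G.ball x₀ (n - h : ℕ)) with hv'
  have h0 : 0 ≤ G.volume (G.ball x₀ (n - 4 ^ k * h : ℕ)) := G.volume_nonneg _
  have hv'v : v' ≤ v := G.volume_mono (hfin _ _) (G.ball_mono x₀
    ((Nat.cast_le.2 (Nat.sub_le _ _)).trans (Nat.floor_le hR0)))
  have h1 : v - v' ≤ ε * v := by
    have h2 : 1 / ε * (v - v') ≤ v := by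
      have := mul_le_mul_of_nonneg_right hk.le (by linarith : 0 ≤ v - v')
      linarith
    rw [one_div, inv_mul_le_iff₀ hε] at h2
    exact h2
  refine le_trans (by linarith : (1 - ε) * v ≤ v') (G.volume_mono (hfin _ _) (G.ball_mono x₀ ?_))
  have hhlt : (n : ℝ) < 4 ^ k * (h + 1) := by
    have := Nat.lt_mul_div_succ n (show 0 < 4 ^ k by positivity)
    rw [← hh] at this
    exact_mod_cast this
  have hRn : R < n + 1 := Nat.lt_floor_add_one R
  have hhn : h ≤ n := Nat.div_le_self _ _
  rw [Nat.cast_sub hhn]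
  have hnR : (n : ℝ) ≤ R := Nat.floor_le hR0
  set a : ℝ := 1 / 4 ^ k with ha
  have ha0 : 0 < a := by positivity
  have ha4 : a * 4 ^ k = 1 := by rw [ha]; field_simp
  have ha1 : a ≤ 1 := by nlinarith
  have hδ : 1 / (4 * 4 ^ k) = a / 4 := by rw [ha]; field_simp
  have h5 : n * a < h + 1 := by nlinarith
  have h6 : 2 ≤ R * a := by nlinarith
  have h7 : (n : ℝ) * (1 - a) ≤ R * (1 - a) := mul_le_mul_of_nonneg_right hnR (by linarith)
  rw [hδ]
  nlinarith [mul_nonneg hR0 (sq_nonneg a)]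

end MultiGraph

/-! ### The killed kernel, and comparison of the growing graph with its limit. -/

namespace MultiGraph

variable {V : Type*}

theorem killed_nonneg (G : MultiGraph V) (S : Set V) (k : ℕ) (x y : V) : 0 ≤ G.killed S k x y := by
  induction k generalizing y with
  | zero => simp only [killed]; split_ifs <;> norm_num
  | succ k ih =>
    simp only [killed]
    split_ifs
    · exact le_rfl
    · exact finsum_nonneg fun z => mul_nonneg (ih z) (G.step_nonneg _ _)

/-- Every edge out of `B` starts on the inner boundary, where the walk is already dead, so the
killed walk never leaves `B`. -/
theorem mem_of_killed_ne_zero (G : MultiGraph V) {B : Set V} {k : ℕ} {x y : V} (hx : x ∈ B)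
    (h : G.killed (G.innerBoundary B) k x y ≠ 0) : y ∈ B ∧ y ∉ G.innerBoundary B := by
  induction k generalizing y with
  | zero =>
    simp only [killed] at h
    split_ifs at h with hy
    · exact ⟨hy.1 ▸ hx, hy.2⟩
    · exact absurd rfl h
  | succ k ih =>
    simp only [killed] at h
    split_ifs at h with hy
    · exact absurd rfl h
    · obtain ⟨z, hz⟩ : ∃ z, G.killed (G.innerBoundary B) k x z * G.step z y ≠ 0 := by
        by_contra! hall
        exact h (by rw [finsum_congr hall, finsum_zero])
      obtain ⟨hzB, hzS⟩ := ih (left_ne_zero_of_mul hz)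
      refine ⟨?_, hy⟩
      by_contra hyB
      refine right_ne_zero_of_mul hz ?_
      have : G.mult z y = 0 := by
        by_contra h0
        exact hzS ⟨hzB, y, hyB, h0⟩
      simp [step, this]

theorem killed_succ_le (G : MultiGraph V) {B : Set V} (hB : B.Finite) [DecidableEq V]
    [DecidablePred (· ∈ G.innerBoundary B)] (k : ℕ) {x : V} (hx : x ∈ B) (y : V) :
    G.killed (G.innerBoundary B) (k + 1) x y ≤
      ∑ z ∈ hB.toFinset.filter (· ∉ G.innerBoundary B),
        G.killed (G.innerBoundary B) k x z * G.step z y := by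
  simp only [killed]
  split_ifs
  · exact Finset.sum_nonneg fun z _ => mul_nonneg (G.killed_nonneg _ _ _ _) (G.step_nonneg _ _)
  · refine le_of_eq (finsum_eq_sum_of_support_subset _ fun z hz => ?_)
    obtain ⟨h1, h2⟩ := G.mem_of_killed_ne_zero hx (left_ne_zero_of_mul hz)
    simpa using ⟨h1, h2⟩

end MultiGraph

namespace GrowingGraph

variable {V : Type*}

theorem degree_le_limit (𝒢 : GrowingGraph V) (t : ℕ) (x : V) :
    (𝒢.graph t).degree x ≤ 𝒢.limit.degree x := by
  have hsub : ∀ y, (𝒢.graph t).mult x y ≠ 0 → y ∈ (𝒢.locallyFinite x).toFinset := by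
    intro y hy
    have := 𝒢.le_limit t x y
    simp only [Set.Finite.mem_toFinset, Set.mem_ofPred_eq]
    omega
  rw [(𝒢.graph t).degree_eq_sum x _ hsub, 𝒢.limit.degree_eq_sum x (𝒢.locallyFinite x).toFinset
    (fun y hy => by simpa using hy)]
  exact Finset.sum_le_sum fun y _ => 𝒢.le_limit t x y

theorem limit_degree_pos (𝒢 : GrowingGraph V) [Infinite V] (x : V) : 0 < 𝒢.limit.degree x := by
  obtain ⟨t, ht⟩ := 𝒢.exists_mem_verts x
  exact (𝒢.degree_pos ht).trans_le (𝒢.degree_le_limit t x)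

namespace BallLike

variable {𝒢 : GrowingGraph V} {x₀ : V} {r : ℝ → ℝ}

theorem mono (hr : 𝒢.BallLike x₀ r) {a b : ℝ} (ha : 0 ≤ a) (hab : a ≤ b) : r a ≤ r b :=
  hr.monotoneOn ha (ha.trans hab) hab

/-- A bounded radius would bound the volumes of the balls, which must eventually exceed half of
`v(t) → ∞`. -/
theorem tendsto_radius (hr : 𝒢.BallLike x₀ r) [Infinite V] :
    Filter.Tendsto (fun t : ℕ => r t) Filter.atTop Filter.atTop := by
  refine Filter.tendsto_atTop_atTop_of_monotone
    (fun a b hab => hr.mono (Nat.cast_nonneg a) (Nat.cast_le.2 hab)) fun M => ?_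
  by_contra! hM
  -- Balls are not yet known to be finite, so `volume_mono` is not available; summing over integer
  -- radii avoids it.
  set C := ∑ n ∈ Finset.range (⌈M⌉₊ + 1), 𝒢.limit.volume (𝒢.limit.ball x₀ (n : ℝ)) with hC
  have hle : ∀ t : ℕ, 𝒢.limit.volume (𝒢.limit.ball x₀ (r t)) ≤ C := by
    intro t
    have h0 : 0 ≤ r t := (hr.pos t (Nat.cast_nonneg t)).le
    rw [← 𝒢.limit.ball_floor x₀ h0]
    refine Finset.single_le_sum (f := fun n : ℕ => 𝒢.limit.volume (𝒢.limit.ball x₀ (n : ℝ)))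
      (fun n _ => MultiGraph.volume_nonneg _ _) (Finset.mem_range.2 (Nat.lt_succ_of_le ?_))
    exact Nat.floor_le_of_le ((hM t).le.trans (Nat.le_ceil M))
  obtain ⟨t, h1, h2, h3⟩ := ((hr.tendsto.eventually_lt_const (by norm_num : (0 : ℝ) < 1 / 2)).and
    ((𝒢.tendsto_vol.eventually_gt_atTop (2 * C)).and
      (𝒢.tendsto_vol.eventually_gt_atTop 0))).exists
  rw [div_lt_iff₀ h3] at h1
  linarith [hle t]

theorem ball_finite (hr : 𝒢.BallLike x₀ r) [Infinite V] (x : V) (R : ℝ) :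
    (𝒢.limit.ball x R).Finite := by
  obtain ⟨t, ht⟩ := (hr.tendsto_radius.eventually_ge_atTop
    (𝒢.limit.toSimple.dist x₀ x + R)).exists
  refine (𝒢.finite_verts t).subset (subset_trans (fun y hy => ?_) (hr.ball_subset t))
  rw [MultiGraph.mem_ball] at hy ⊢
  have h := 𝒢.limit_connected.dist_triangle (u := x₀) (v := x) (w := y)
  have h' : (𝒢.limit.toSimple.dist x₀ y : ℝ) ≤
    𝒢.limit.toSimple.dist x₀ x + 𝒢.limit.toSimple.dist x y := by exact_mod_cast h
  linarith

/-- At a vertex of the ball all of whose neighbours are in the ball, the graph at time `t` agrees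
with the limit graph. -/
theorem mult_eq (hr : 𝒢.BallLike x₀ r) {t : ℕ} {m : ℝ} (hm : m ≤ r t) {x : V}
    (hx : x ∈ 𝒢.limit.ball x₀ m) (hx' : x ∉ 𝒢.limit.innerBoundary (𝒢.limit.ball x₀ m)) :
    (𝒢.graph t).mult x = 𝒢.limit.mult x := by
  funext y
  by_cases hy : y ∈ 𝒢.limit.ball x₀ m
  · exact hr.ball_induced t x (𝒢.limit.ball_mono x₀ hm hx) y (𝒢.limit.ball_mono x₀ hm hy)
  · have h0 : 𝒢.limit.mult x y = 0 := by
      by_contra h0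
      exact hx' ⟨hx, y, hy, h0⟩
    have := 𝒢.le_limit t x y
    omega

theorem degree_eq (hr : 𝒢.BallLike x₀ r) {t : ℕ} {m : ℝ} (hm : m ≤ r t) {x : V}
    (hx : x ∈ 𝒢.limit.ball x₀ m) (hx' : x ∉ 𝒢.limit.innerBoundary (𝒢.limit.ball x₀ m)) :
    (𝒢.graph t).degree x = 𝒢.limit.degree x := by
  unfold MultiGraph.degree
  rw [hr.mult_eq hm hx hx']

end BallLike

theorem notMem_innerBoundary (𝒢 : GrowingGraph V) {x₀ x : V} {R S : ℝ}
    (hx : x ∈ 𝒢.limit.ball x₀ R) (hRS : R + 1 ≤ S) :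
    x ∉ 𝒢.limit.innerBoundary (𝒢.limit.ball x₀ S) := by
  rintro ⟨_, y, hy, h0⟩
  refine hy ?_
  rw [MultiGraph.mem_ball] at hx ⊢
  have h := 𝒢.limit.dist_le_succ_of_mult_ne_zero 𝒢.limit_connected x₀ h0
  have h' : (𝒢.limit.toSimple.dist x₀ y : ℝ) ≤ 𝒢.limit.toSimple.dist x₀ x + 1 := by
    exact_mod_cast h
  linarith

namespace BallLike

variable {𝒢 : GrowingGraph V} {x₀ : V} {r : ℝ → ℝ}

/-- The margin 1 puts all neighbours of the ball inside `B(x₀, r(t))`, so its vertices already have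
their final degrees. -/
theorem volume_ball_eq (hr : 𝒢.BallLike x₀ r) [Infinite V] {t : ℕ} {R : ℝ} (hR : R + 1 ≤ r t) :
    𝒢.limit.volume (𝒢.limit.ball x₀ R) =
      ∑ x ∈ (hr.ball_finite x₀ R).toFinset, ((𝒢.graph t).degree x : ℝ) := by
  rw [MultiGraph.volume_eq_sum _ (hr.ball_finite x₀ R)]
  refine Finset.sum_congr rfl fun x hx => ?_
  have hx' : x ∈ 𝒢.limit.ball x₀ R := (Set.Finite.mem_toFinset _).1 hx
  rw [hr.degree_eq le_rfl (𝒢.limit.ball_mono x₀ (by linarith) hx')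
    (𝒢.notMem_innerBoundary hx' hR)]

theorem ball_subset_vertFinset (hr : 𝒢.BallLike x₀ r) [Infinite V] {t : ℕ} {R : ℝ} (hR : R ≤ r t) :
    (hr.ball_finite x₀ R).toFinset ⊆ 𝒢.vertFinset t := fun _ hx =>
  𝒢.mem_vertFinset.2 (hr.ball_subset t (𝒢.limit.ball_mono x₀ hR ((Set.Finite.mem_toFinset _).1 hx)))

theorem volume_ball_le (hr : 𝒢.BallLike x₀ r) [Infinite V] {t : ℕ} {R : ℝ} (hR : R + 1 ≤ r t) :
    𝒢.limit.volume (𝒢.limit.ball x₀ R) ≤ 𝒢.vol t := by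
  rw [hr.volume_ball_eq hR, vol_eq]
  exact Finset.sum_le_sum_of_subset_of_nonneg (hr.ball_subset_vertFinset (by linarith))
    fun _ _ _ => Nat.cast_nonneg _

/-- While the ball `B(x₀, m)` is in the growing graph, the walk dominates the walk on the limit
graph killed at the inner boundary of this ball. -/
theorem sum_transProb_mul_killed_le (hr : 𝒢.BallLike x₀ r) [Infinite V] (h₀ : x₀ ∈ 𝒢.verts 0)
    {s : ℕ} {m : ℝ} (hm : m ≤ r s) (A : Finset V) (hA : ∀ x ∈ A, x ∈ 𝒢.limit.ball x₀ m) (k : ℕ)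
    (y : V) :
    ∑ x ∈ A, 𝒢.transProb x₀ s x *
      𝒢.limit.killed (𝒢.limit.innerBoundary (𝒢.limit.ball x₀ m)) k x y ≤
        𝒢.transProb x₀ (s + k) y := by
  classical
  set B := 𝒢.limit.ball x₀ m with hB
  set S := 𝒢.limit.innerBoundary B with hS
  have hBf : B.Finite := hr.ball_finite x₀ m
  induction k generalizing y with
  | zero =>
    calc _ ≤ ∑ x ∈ A, if x = y then 𝒢.transProb x₀ s y else 0 := by
          refine Finset.sum_le_sum fun x _ => ?_
          simp only [MultiGraph.killed]
          by_cases hxy : x = y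
          · subst hxy
            have := 𝒢.transProb_nonneg x₀ s x
            split_ifs <;> simp_all
          · simp [hxy]
      _ ≤ 𝒢.transProb x₀ (s + 0) y := by
          rw [Finset.sum_ite_eq']
          split_ifs
          · exact le_rfl
          · exact 𝒢.transProb_nonneg _ _ _
  | succ k ih =>
    set F := hBf.toFinset.filter (· ∉ S) with hF
    calc _ ≤ ∑ x ∈ A, 𝒢.transProb x₀ s x * ∑ z ∈ F, 𝒢.limit.killed S k x z * 𝒢.limit.step z y :=
          Finset.sum_le_sum fun x hx => mul_le_mul_of_nonneg_left
            (𝒢.limit.killed_succ_le hBf k (hA x hx) y) (𝒢.transProb_nonneg _ _ _)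
      _ = ∑ z ∈ F, (∑ x ∈ A, 𝒢.transProb x₀ s x * 𝒢.limit.killed S k x z) * 𝒢.limit.step z y := by
          simp only [Finset.mul_sum, Finset.sum_mul]
          rw [Finset.sum_comm]
          exact Finset.sum_congr rfl fun z _ => Finset.sum_congr rfl fun x _ => by ring
      _ ≤ ∑ z ∈ F, 𝒢.transProb x₀ (s + k) z * (𝒢.graph (s + k)).step z y := by
          refine Finset.sum_le_sum fun z hz => ?_
          obtain ⟨hz1, hz2⟩ := Finset.mem_filter.1 hz
          have hz1' : z ∈ B := (Set.Finite.mem_toFinset _).1 hz1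
          have hm' : m ≤ r (s + k : ℕ) :=
            hm.trans (hr.mono (Nat.cast_nonneg s) (Nat.cast_le.2 (Nat.le_add_right s k)))
          -- Off the inner boundary all limit edges at `z` stay in `B`, hence are present from time
          -- `s` on.
          have hst : (𝒢.graph (s + k)).step z y = 𝒢.limit.step z y := by
            unfold MultiGraph.step
            rw [hr.mult_eq hm' hz1' hz2, hr.degree_eq hm' hz1' hz2]
          rw [hst]
          exact mul_le_mul_of_nonneg_right (ih z) (MultiGraph.step_nonneg _ _ _)
      _ ≤ 𝒢.transProb x₀ (s + (k + 1)) y := 𝒢.transProb_mul_step_le h₀ (s + k) F y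

/-- The walk at a large time is in a slightly smaller ball than the ball contained in the graph, with
probability at least `1 / 2`. -/
theorem eventually_half_le (hr : 𝒢.BallLike x₀ r) [Infinite V] (h₀ : x₀ ∈ 𝒢.verts 0) {C δ R₀ : ℝ}
    (hC : 0 < C) (hδ : 0 < δ) (hδ' : δ ≤ 1 / 4)
    (hen : ∀ᶠ t : ℕ in Filter.atTop, 𝒢.energy x₀ t ≤ C / 𝒢.vol t)
    (hvol : ∀ R, R₀ ≤ R → (1 - 1 / (8 * C)) * 𝒢.limit.volume (𝒢.limit.ball x₀ R) ≤
      𝒢.limit.volume (𝒢.limit.ball x₀ ((1 - δ) ^ 2 * R))) :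
    ∀ᶠ t : ℕ in Filter.atTop,
      1 / 2 ≤ ∑ x ∈ (hr.ball_finite x₀ ((1 - δ) ^ 2 * r t)).toFinset, 𝒢.transProb x₀ t x := by
  classical
  -- Chosen so that `q ^ 2 ≤ (C / v) * (2 * ε * v) = 1 / 4`; one `ε` pays for the annulus, the other
  -- for `V_t` not being a ball.
  set ε := 1 / (8 * C) with hε
  have hε0 : 0 < ε := by positivity
  filter_upwards [hen, hr.tendsto_radius.eventually_ge_atTop R₀,
    hr.tendsto_radius.eventually_ge_atTop (1 / δ), hr.tendsto.eventually_lt_const hε0]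
    with t h1 h2 h3 h4
  have hv : 0 < 𝒢.vol t := 𝒢.vol_pos (𝒢.verts_mono (Nat.zero_le t) h₀)
  set R := (1 - δ) ^ 2 * r t with hR
  rw [div_le_iff₀ hδ] at h3
  have hrt : 0 < r t := hr.pos t (Nat.cast_nonneg t)
  have hR1 : R + 1 ≤ r t := by
    have : (1 - δ) ^ 2 ≤ 1 - δ := by nlinarith
    have := mul_le_mul_of_nonneg_right this hrt.le
    linarith
  set A := (hr.ball_finite x₀ R).toFinset with hA
  set W := 𝒢.vertFinset t with hW
  have hAW : A ⊆ W := hr.ball_subset_vertFinset (by linarith)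
  have hdeg : ∀ x ∈ W, (0 : ℝ) < (𝒢.graph t).degree x := fun x hx =>
    Nat.cast_pos.2 (𝒢.degree_pos (𝒢.mem_vertFinset.1 hx))
  set q := ∑ x ∈ W \ A, 𝒢.transProb x₀ t x with hq
  have hsum : q + ∑ x ∈ A, 𝒢.transProb x₀ t x = 1 := by
    rw [hq, Finset.sum_sdiff hAW, 𝒢.sum_transProb h₀]
  have hd : ∑ x ∈ W \ A, ((𝒢.graph t).degree x : ℝ) =
      𝒢.vol t - 𝒢.limit.volume (𝒢.limit.ball x₀ R) := by
    rw [hr.volume_ball_eq hR1, vol_eq, ← Finset.sum_sdiff hAW]; ring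
  have hCS : q ^ 2 ≤ 𝒢.energy x₀ t * (𝒢.vol t - 𝒢.limit.volume (𝒢.limit.ball x₀ R)) := by
    rw [← hd]
    refine (Finset.sum_sq_le_sum_mul_sum_of_sq_le_mul (W \ A)
      (f := fun x => 𝒢.transProb x₀ t x ^ 2 / (𝒢.graph t).degree x)
      (g := fun x => ((𝒢.graph t).degree x : ℝ)) (fun x _ => by positivity)
      (fun x _ => Nat.cast_nonneg _) (fun x hx => le_of_eq ?_)).trans ?_
    · have := (hdeg x (Finset.sdiff_subset hx)).ne'
      field_simp
    · refine mul_le_mul_of_nonneg_right ?_ (Finset.sum_nonneg fun x _ => Nat.cast_nonneg _)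
      exact Finset.sum_le_sum_of_subset_of_nonneg Finset.sdiff_subset fun x _ _ => by positivity
  have hsmall : 𝒢.vol t - 𝒢.limit.volume (𝒢.limit.ball x₀ R) ≤ 2 * ε * 𝒢.vol t := by
    have h5 := hvol (r t) h2
    rw [div_lt_iff₀ hv] at h4
    set b := 𝒢.limit.volume (𝒢.limit.ball x₀ (r t)) with hb
    have hb0 : 0 ≤ b := MultiGraph.volume_nonneg _ _
    -- `b` uses limit degrees, which near the sphere of radius `r(t)` can exceed those at time `t`,
    -- so `b` may be larger than `v(t)`.
    rcases le_total b (𝒢.vol t) with h | h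
    · nlinarith
    · nlinarith [mul_pos hε0 hv, MultiGraph.volume_nonneg 𝒢.limit (𝒢.limit.ball x₀ R)]
  have hq2 : q ^ 2 ≤ 1 / 4 := by
    refine hCS.trans ((mul_le_mul_of_nonneg_left hsmall (𝒢.energy_nonneg x₀ t)).trans
      ((mul_le_mul_of_nonneg_right h1 (by positivity)).trans (le_of_eq ?_)))
    rw [hε]; field_simp; norm_num
  nlinarith [sq_nonneg (q - 1 / 2)]

end BallLike

end GrowingGraph

/-! ### Generalized inverses and the pointwise lower bound. -/

namespace GrowingGraph

variable {V : Type*}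

namespace BallLike

variable {𝒢 : GrowingGraph V} {x₀ : V} {r : ℝ → ℝ}

theorem genInv_spec (hr : 𝒢.BallLike x₀ r) [Infinite V] (m : ℝ) :
    0 ≤ genInv r m ∧ m ≤ r (genInv r m) := by
  obtain ⟨t, ht⟩ := (hr.tendsto_radius.eventually_ge_atTop m).exists
  have hcl : IsClosed {s : ℝ | 0 ≤ s ∧ m ≤ r s} :=
    hr.continuousOn.preimage_isClosed_of_isClosed isClosed_Ici isClosed_Ici
  exact hcl.csInf_mem ⟨t, Nat.cast_nonneg t, ht⟩ ⟨0, fun _ h => h.1⟩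

theorem genInv_mono (hr : 𝒢.BallLike x₀ r) [Infinite V] {m m' : ℝ} (h : m ≤ m') :
    genInv r m ≤ genInv r m' := by
  obtain ⟨h1, h2⟩ := hr.genInv_spec m'
  exact csInf_le ⟨0, fun _ h => h.1⟩ ⟨h1, h.trans h2⟩

/-- A radius `m' > r(s)` is first attained after time `s`, and `ψ m' ≥ ψ m`, so its total time
exceeds `T`. -/
theorem reach_le (hr : 𝒢.BallLike x₀ r) [Infinite V] {ψ : ℝ → ℝ} (hψ : MonotoneOn ψ (Set.Ioi 0))
    {s m T : ℝ} (hs : 0 ≤ s) (hm : 0 < m) (hmr : m ≤ r s) (hT : s + ψ m = T) :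
    reach r ψ T ≤ r s := by
  refine Real.sSup_le (fun m' ⟨hm', h⟩ => ?_) (hr.pos s hs).le
  by_contra! hlt
  obtain ⟨h1, h2⟩ := hr.genInv_spec m'
  have h3 : s < genInv r m' := by
    by_contra! hle
    linarith [hr.mono h1 hle]
  have h4 : ψ m ≤ ψ m' := hψ hm hm' (by linarith)
  linarith

/-- The supremum in the definition of `reach` is attained. -/
theorem reach_le_radius (hr : 𝒢.BallLike x₀ r) [Infinite V] {ψ : ℝ → ℝ}
    (hψc : ContinuousOn ψ (Set.Ioi 0)) (hψ : MonotoneOn ψ (Set.Ioi 0)) {T : ℝ}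
    (hpos : 0 < reach r ψ T) :
    ψ (reach r ψ T) ≤ T ∧ reach r ψ T ≤ r (T - ψ (reach r ψ T)) := by
  set M := reach r ψ T with hM
  have hbelow : ∀ m ∈ Set.Ioo 0 M, genInv r m + ψ m ≤ T := by
    rintro m ⟨hm0, hmM⟩
    have hne : {m : ℝ | 0 < m ∧ genInv r m + ψ m ≤ T}.Nonempty := by
      by_contra h
      rw [Set.not_nonempty_iff_eq_empty] at h
      rw [hM, reach, h, Real.sSup_empty] at hpos
      exact lt_irrefl _ hpos
    obtain ⟨m', ⟨h1, h2⟩, h3⟩ := exists_lt_of_lt_csSup hne hmM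
    have h4 := hψ hm0 h1 h3.le
    linarith [hr.genInv_mono h3.le]
  have hlim : Filter.Tendsto (fun m => T - ψ m) (nhdsWithin M (Set.Iio M)) (nhds (T - ψ M)) :=
    (tendsto_const_nhds.sub
      ((hψc.continuousAt (Ioi_mem_nhds hpos)).tendsto)).mono_left nhdsWithin_le_nhds
  have hev : ∀ᶠ m in nhdsWithin M (Set.Iio M), m ∈ Set.Ioo 0 M := Ioo_mem_nhdsLT hpos
  have hnn : ∀ᶠ m in nhdsWithin M (Set.Iio M), T - ψ m ∈ Set.Ici (0 : ℝ) := by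
    filter_upwards [hev] with m hm
    have := hbelow m hm
    have := (hr.genInv_spec m).1
    exact Set.mem_Ici.2 (by linarith)
  have h0 : 0 ≤ T - ψ M := ge_of_tendsto hlim hnn
  -- The limit from below is taken in `m ≤ r (T - ψ m)`, which needs continuity of `r` and `ψ` only
  -- and none of `genInv`.
  have hlim2 : Filter.Tendsto (fun m => r (T - ψ m)) (nhdsWithin M (Set.Iio M))
      (nhds (r (T - ψ M))) :=
    (hr.continuousOn _ h0).tendsto.comp (tendsto_nhdsWithin_iff.2 ⟨hlim, hnn⟩)
  refine ⟨by linarith, le_of_tendsto_of_tendsto 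
    (Filter.tendsto_id.mono_left nhdsWithin_le_nhds) hlim2 ?_⟩
  filter_upwards [hev] with m hm
  have h1 := hbelow m hm
  obtain ⟨h2, h3⟩ := hr.genInv_spec m
  exact h3.trans (hr.mono h2 (by linarith))

theorem volume_ball_pos (hr : 𝒢.BallLike x₀ r) [Infinite V] {R : ℝ} (hR : 0 ≤ R) :
    0 < 𝒢.limit.volume (𝒢.limit.ball x₀ R) := by
  rw [MultiGraph.volume_eq_sum _ (hr.ball_finite x₀ R)]
  refine Finset.sum_pos (fun x _ => Nat.cast_pos.2 (𝒢.limit_degree_pos x)) ⟨x₀, ?_⟩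
  rw [Set.Finite.mem_toFinset, MultiGraph.mem_ball, SimpleGraph.dist_self]
  exact_mod_cast hR

/-- With positive probability the walk is at `x₀` when `⌊ψ M⌋` steps remain, and LLE then leads to
`y`. For `y ≠ x₀` the hypothesis forces `M ≥ 2`, which keeps both points off the inner boundary; for
`y = x₀` laziness is enough. -/
theorem transProb_pos (hr : 𝒢.BallLike x₀ r) [Infinite V] (h₀ : x₀ ∈ 𝒢.verts 0) {γ : ℝ}
    (hγ : 0 < γ) (hlazy : 𝒢.Lazy γ) {ψ cHK : ℝ → ℝ} (hψc : ContinuousOn ψ (Set.Ioi 0))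
    (hψ : MonotoneOn ψ (Set.Ioi 0)) (hψ0 : ∀ m, 0 < m → 0 < ψ m) (hc : 0 < cHK (1 / 2))
    (hLLE : 𝒢.limit.LLE x₀ ψ cHK) (t : ℕ) {y : V}
    (hy : (𝒢.limit.toSimple.dist x₀ y : ℝ) ≤ (1 - 1 / 2) * reach r ψ t) :
    0 < 𝒢.transProb x₀ t y := by
  have hstay : ∀ s, 0 < 𝒢.transProb x₀ s x₀ := fun s =>
    𝒢.transProb_pos_of_le h₀ hγ hlazy (Nat.zero_le s) (by simp [transProb])
  rcases Nat.eq_zero_or_pos (𝒢.limit.toSimple.dist x₀ y) with hd | hd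
  · rw [← 𝒢.limit_connected.dist_eq_zero_iff.1 hd]
    exact hstay t
  · have hd1 : (1 : ℝ) ≤ 𝒢.limit.toSimple.dist x₀ y := by exact_mod_cast hd
    set M := reach r ψ t with hM
    obtain ⟨h1, h2⟩ := hr.reach_le_radius (T := (t : ℝ)) hψc hψ (by linarith)
    rw [← hM] at h1 h2
    set k := ⌊ψ M⌋₊ with hk
    have hψM : 0 < ψ M := hψ0 M (by linarith)
    have hkle : (k : ℝ) ≤ ψ M := Nat.floor_le hψM.le
    have hkt : k ≤ t := by exact_mod_cast hkle.trans h1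
    have hMs : M ≤ r (t - k : ℕ) := by
      rw [Nat.cast_sub hkt]
      exact h2.trans (hr.mono (by linarith) (by linarith))
    have hx₀ : x₀ ∈ 𝒢.limit.ball x₀ 0 := by
      rw [MultiGraph.mem_ball, SimpleGraph.dist_self, Nat.cast_zero]
    have hk1 := hLLE (1 / 2) (by norm_num) (by norm_num) M (by linarith) x₀
      ⟨𝒢.limit.ball_mono x₀ (by linarith) hx₀, 𝒢.notMem_innerBoundary hx₀ (by linarith)⟩ y
      ⟨hy, 𝒢.notMem_innerBoundary (MultiGraph.mem_ball.2 le_rfl) (by linarith)⟩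
    have hk2 := (div_pos hc (hr.volume_ball_pos (R := M) (by linarith))).trans_le hk1
    have h3 := hr.sum_transProb_mul_killed_le h₀ hMs {x₀} (fun x hx => by
      rw [Finset.mem_singleton.1 hx]
      exact 𝒢.limit.ball_mono x₀ (by linarith) hx₀) k y
    rw [Finset.sum_singleton, Nat.sub_add_cancel hkt] at h3
    exact (mul_pos (hstay _) hk2).trans_le h3

theorem eventually_lower_bound (hr : 𝒢.BallLike x₀ r) [Infinite V] (h₀ : x₀ ∈ 𝒢.verts 0) {γ : ℝ}
    (hγ : 0 < γ) (hγ' : γ ≤ 1) (hlazy : 𝒢.Lazy γ) {ψ cHK : ℝ → ℝ}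
    (hψc : ContinuousOn ψ (Set.Ioi 0)) (hψ : MonotoneOn ψ (Set.Ioi 0))
    (hψ0 : ∀ m, 0 < m → 0 < ψ m) {δ : ℝ} (hδ : 0 < δ) (hδ' : δ ≤ 1 / 4) (hc : 0 < cHK δ)
    (hLLE : 𝒢.limit.LLE x₀ ψ cHK)
    (hhalf : ∀ᶠ t : ℕ in Filter.atTop,
      1 / 2 ≤ ∑ x ∈ (hr.ball_finite x₀ ((1 - δ) ^ 2 * r t)).toFinset, 𝒢.transProb x₀ t x) :
    ∃ t₀ : ℕ, ∀ t : ℕ, t₀ ≤ t → ∀ y : V,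
      (𝒢.limit.toSimple.dist x₀ y : ℝ) ≤ (1 - 1 / 2) * reach r ψ t →
        γ * cHK δ / 2 / 𝒢.vol t ≤ 𝒢.transProb x₀ t y := by
  obtain ⟨T, hT⟩ := Filter.eventually_atTop.1
    -- `δ * r ≥ 2` later yields `δ * m ≥ 1` for `m = (1 - δ) * r(s)`, so `B(x₀, (1 - δ) * m)` avoids
    -- the inner boundary of `B(x₀, m)`.
    (hhalf.and (hr.tendsto_radius.eventually_ge_atTop (2 / δ)))
  set F : ℝ → ℝ := fun s => s + ψ ((1 - δ) * r s) with hF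
  have hpos : ∀ s, 0 ≤ s → 0 < (1 - δ) * r s := fun s hs =>
    mul_pos (by linarith) (hr.pos s hs)
  have hFc : ContinuousOn F (Set.Ici 0) :=
    continuousOn_id.add (hψc.comp (continuousOn_const.mul hr.continuousOn) fun s hs => hpos s hs)
  have hFm : ∀ a b, 0 ≤ a → a ≤ b → F a ≤ F b := fun a b ha hab =>
    add_le_add hab (hψ (hpos a ha) (hpos b (ha.trans hab))
      (mul_le_mul_of_nonneg_left (hr.mono ha hab) (by linarith)))
  refine ⟨⌈F T⌉₊ + 1, fun t ht y hy => ?_⟩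
  have hFT : F T < t := by
    have h1 := Nat.le_ceil (F T)
    have h2 : ((⌈F T⌉₊ : ℝ) + 1) ≤ t := by exact_mod_cast ht
    linarith
  have hF0 : F 0 ≤ F T := hFm 0 T le_rfl (Nat.cast_nonneg T)
  have hFt : (t : ℝ) ≤ F t := by
    have := hψ0 _ (hpos t (Nat.cast_nonneg t))
    simp only [hF]; linarith
  -- Split the time: `s` to fill the ball, then exactly `ψ m` for LLE at radius `m = (1 - δ) *
  -- r(s)`.
  obtain ⟨s, ⟨hs0, hst⟩, hs⟩ := intermediate_value_Icc (Nat.cast_nonneg t)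
    (hFc.mono Set.Icc_subset_Ici_self) ⟨by linarith, hFt⟩
  have hTs : (T : ℝ) ≤ s := by
    by_contra! hlt
    linarith [hFm s T hs0 hlt.le]
  have hfl : T ≤ ⌊s⌋₊ := Nat.le_floor hTs
  obtain ⟨hh, hrad⟩ := hT _ hfl
  rw [div_le_iff₀ hδ] at hrad
  have hrs : r (⌊s⌋₊ : ℕ) ≤ r s := hr.mono (Nat.cast_nonneg _) (Nat.floor_le hs0)
  have hrs0 := hr.pos s hs0
  set m := (1 - δ) * r s with hm
  have hm0 : 0 < m := hpos s hs0
  have hδm : 1 ≤ δ * m := by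
    have : 2 ≤ r s * δ := hrad.trans (mul_le_mul_of_nonneg_right hrs hδ.le)
    rw [hm]; nlinarith
  have hδr : 1 ≤ δ * r s := by nlinarith
  have hm1 : 1 ≤ m := by nlinarith
  have hψm : s + ψ m = t := hs
  set s₁ := ⌈s⌉₊ with hs₁
  have hs1t : s₁ ≤ t := Nat.ceil_le.2 hst
  have hceil := Nat.le_ceil s
  have hceil' := Nat.ceil_lt_add_one hs0
  rw [← hs₁] at hceil hceil'
  -- As `t` is an integer, rounding `ψ m` down means rounding `s` up. The half-mass bound is known
  -- at `⌊s⌋`, whence the factor `γ` in `hlz`.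
  have hk : ⌊ψ m⌋₊ = t - s₁ := by
    rw [Nat.floor_eq_iff (hψ0 m hm0).le, Nat.cast_sub hs1t]
    constructor <;> linarith
  have hlz : ∀ x, γ * 𝒢.transProb x₀ ⌊s⌋₊ x ≤ 𝒢.transProb x₀ s₁ x := by
    intro x
    have h1 : s₁ ≤ ⌊s⌋₊ + 1 := Nat.ceil_le_floor_add_one s
    have h2 : ⌊s⌋₊ ≤ s₁ := Nat.floor_le_ceil s
    rcases Nat.lt_or_ge ⌊s⌋₊ s₁ with h | h
    · rw [show s₁ = ⌊s⌋₊ + 1 by omega]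
      exact 𝒢.mul_transProb_le_succ h₀ hlazy _ x
    · rw [show s₁ = ⌊s⌋₊ by omega]
      exact mul_le_of_le_one_left (𝒢.transProb_nonneg _ _ _) hγ'
  set A := (hr.ball_finite x₀ ((1 - δ) * m)).toFinset with hA
  have hAmem : ∀ x ∈ A, x ∈ 𝒢.limit.ball x₀ ((1 - δ) * m) := fun x hx =>
    (Set.Finite.mem_toFinset _).1 hx
  have hmass : γ / 2 ≤ ∑ x ∈ A, 𝒢.transProb x₀ s₁ x := by
    calc γ / 2 = γ * (1 / 2) := by ring
      _ ≤ γ * ∑ x ∈ (hr.ball_finite x₀ ((1 - δ) ^ 2 * r ⌊s⌋₊)).toFinset,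
            𝒢.transProb x₀ ⌊s⌋₊ x := mul_le_mul_of_nonneg_left hh hγ.le
      _ ≤ γ * ∑ x ∈ A, 𝒢.transProb x₀ ⌊s⌋₊ x := by
          refine mul_le_mul_of_nonneg_left (Finset.sum_le_sum_of_subset_of_nonneg ?_
            fun x _ _ => 𝒢.transProb_nonneg _ _ _) hγ.le
          rw [hA, Set.Finite.toFinset_subset_toFinset]
          refine 𝒢.limit.ball_mono x₀ ?_
          rw [hm, ← mul_assoc, ← sq]
          exact mul_le_mul_of_nonneg_left hrs (sq_nonneg _)
      _ ≤ _ := by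
          rw [Finset.mul_sum]
          exact Finset.sum_le_sum fun x _ => hlz x
  have hms : m + 1 ≤ r s := by rw [hm]; linarith
  have hmono : (1 - δ) * m ≤ m := by nlinarith
  have hreach := hr.reach_le hψ hs0 hm0 (by linarith) hψm
  -- Here `1 / 2 ≤ (1 - δ) ^ 2`, because `δ ≤ 1 / 4`.
  have hyb : y ∈ 𝒢.limit.ball x₀ ((1 - δ) * m) := by
    rw [MultiGraph.mem_ball, hm]
    nlinarith
  set v := 𝒢.limit.volume (𝒢.limit.ball x₀ m) with hv
  have hv0 : 0 < v := hr.volume_ball_pos hm0.le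
  have hvt : v ≤ 𝒢.vol t := hr.volume_ball_le (hms.trans (hr.mono hs0 hst))
  have hkill : ∀ x ∈ A, cHK δ / v ≤
      𝒢.limit.killed (𝒢.limit.innerBoundary (𝒢.limit.ball x₀ m)) ⌊ψ m⌋₊ x y := fun x hx =>
    hLLE δ hδ (by linarith) m hm1 x
      ⟨hAmem x hx, 𝒢.notMem_innerBoundary (hAmem x hx) (by linarith)⟩ y
      ⟨hyb, 𝒢.notMem_innerBoundary hyb (by linarith)⟩
  calc γ * cHK δ / 2 / 𝒢.vol t ≤ γ * cHK δ / 2 / v :=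
        div_le_div_of_nonneg_left (by positivity) hv0 hvt
    _ = γ / 2 * (cHK δ / v) := by ring
    _ ≤ (∑ x ∈ A, 𝒢.transProb x₀ s₁ x) * (cHK δ / v) :=
        mul_le_mul_of_nonneg_right hmass (by positivity)
    _ ≤ ∑ x ∈ A, 𝒢.transProb x₀ s₁ x *
          𝒢.limit.killed (𝒢.limit.innerBoundary (𝒢.limit.ball x₀ m)) ⌊ψ m⌋₊ x y := by
        rw [Finset.sum_mul]
        exact Finset.sum_le_sum fun x hx =>
          mul_le_mul_of_nonneg_left (hkill x hx) (𝒢.transProb_nonneg _ _ _)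
    _ ≤ 𝒢.transProb x₀ t y := by
        have := hr.sum_transProb_mul_killed_le h₀ (s := s₁) (m := m)
          ((by linarith : m ≤ r s).trans (hr.mono hs0 hceil)) A
          (fun x hx => 𝒢.limit.ball_mono x₀ hmono (hAmem x hx)) ⌊ψ m⌋₊ y
        rwa [hk, Nat.add_sub_cancel' hs1t, ← hk] at this

end BallLike

/-! ### Early times, and passage from the kernel to the process. -/

theorem exists_pos_forall_lt (𝒢 : GrowingGraph V) {x₀ : V} (h₀ : x₀ ∈ 𝒢.verts 0)
    (P : ℕ → V → Prop) (hP : ∀ t y, P t y → 0 < 𝒢.transProb x₀ t y) (T : ℕ) :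
    ∃ c : ℝ, 0 < c ∧ ∀ t < T, ∀ y ∈ 𝒢.verts t, P t y → c / 𝒢.vol t ≤ 𝒢.transProb x₀ t y := by
  classical
  have hv : ∀ t, 0 < 𝒢.vol t := fun t => 𝒢.vol_pos (𝒢.verts_mono (Nat.zero_le t) h₀)
  induction T with
  | zero => exact ⟨1, one_pos, by simp⟩
  | succ T ih =>
    obtain ⟨c, hc, h⟩ := ih
    obtain ⟨b, hb, hb'⟩ : ∃ b : ℝ, 0 < b ∧
        ∀ y ∈ 𝒢.verts T, P T y → b / 𝒢.vol T ≤ 𝒢.transProb x₀ T y := by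
      rcases ((𝒢.vertFinset T).filter (P T)).eq_empty_or_nonempty with he | hne
      · refine ⟨1, one_pos, fun y hy hPy => ?_⟩
        have : y ∈ (𝒢.vertFinset T).filter (P T) :=
          Finset.mem_filter.2 ⟨𝒢.mem_vertFinset.2 hy, hPy⟩
        simp [he] at this
      · obtain ⟨z, hz, hmin⟩ := Finset.exists_min_image _ (𝒢.transProb x₀ T) hne
        refine ⟨𝒢.transProb x₀ T z * 𝒢.vol T, mul_pos (hP T z (Finset.mem_filter.1 hz).2) (hv T),
          fun y hy hPy => ?_⟩
        rw [mul_div_cancel_right₀ _ (hv T).ne']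
        exact hmin y (Finset.mem_filter.2 ⟨𝒢.mem_vertFinset.2 hy, hPy⟩)
    refine ⟨min c b, lt_min hc hb, fun t ht y hy hPy => ?_⟩
    rcases Nat.lt_succ_iff_lt_or_eq.1 ht with hlt | rfl
    · exact (div_le_div_of_nonneg_right (min_le_left _ _) (hv t).le).trans (h t hlt y hy hPy)
    · exact (div_le_div_of_nonneg_right (min_le_right _ _) (hv t).le).trans (hb' y hy hPy)

open MeasureTheory in
-- Divergence of the expected number of visits needs only this direction. The Markov property is
-- used with the trivial past event.
theorem IsWalk.ofReal_transProb_le {𝒢 : GrowingGraph V} {x₀ : V} (h₀ : x₀ ∈ 𝒢.verts 0) {Ω : Type*}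
    [MeasurableSpace Ω] {μ : Measure Ω} [IsProbabilityMeasure μ] {X : ℕ → Ω → V}
    (hX : 𝒢.IsWalk x₀ μ X) (t : ℕ) (y : V) :
    ENNReal.ofReal (𝒢.transProb x₀ t y) ≤ μ {ω | X t ω = y} := by
  have hmeas : ∀ t y, MeasurableSet {ω | X t ω = y} := fun t y =>
    hX.measurable t (MeasurableSpace.measurableSet_top (s := {y}))
  induction t generalizing y with
  | zero =>
    simp only [transProb]
    split_ifs with h
    · subst h
      rw [(mem_ae_iff_prob_eq_one (hmeas 0 y)).1 hX.start]
      simp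
    · simp
  | succ t ih =>
    rw [𝒢.transProb_succ h₀ (W := 𝒢.vertFinset t) (by simp) y, ENNReal.ofReal_sum_of_nonneg
      fun z _ => mul_nonneg (𝒢.transProb_nonneg _ _ _) (MultiGraph.step_nonneg _ _ _)]
    calc _ ≤ ∑ z ∈ 𝒢.vertFinset t, μ ({ω | X t ω = z} ∩ {ω | X (t + 1) ω = y}) := by
          refine Finset.sum_le_sum fun z hz => ?_
          have h1 := hX.markov t Set.univ MeasurableSet.univ z (𝒢.mem_vertFinset.1 hz) y
          rw [Set.univ_inter] at h1
          rw [h1, ENNReal.ofReal_mul (𝒢.transProb_nonneg _ _ _)]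
          exact mul_le_mul_left (ih z) _
      _ = μ (⋃ z ∈ 𝒢.vertFinset t, {ω | X t ω = z} ∩ {ω | X (t + 1) ω = y}) := by
          refine (measure_biUnion_finset (fun z _ w _ hzw => ?_)
            fun z _ => (hmeas t z).inter (hmeas (t + 1) y)).symm
          refine Set.disjoint_left.2 fun ω h1 h2 => hzw ?_
          exact h1.1.symm.trans h2.1
      _ ≤ μ {ω | X (t + 1) ω = y} := by
          refine measure_mono fun ω hω => ?_
          simp only [Set.mem_iUnion] at hω
          obtain ⟨z, _, hz⟩ := hω
          exact hz.2

open MeasureTheory in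
theorem IsWalk.weaklyRecurrent {𝒢 : GrowingGraph V} {x₀ : V} (h₀ : x₀ ∈ 𝒢.verts 0) {Ω : Type*}
    [MeasurableSpace Ω] {μ : Measure Ω} [IsProbabilityMeasure μ] {X : ℕ → Ω → V}
    (hX : 𝒢.IsWalk x₀ μ X) (hsum : ¬ Summable fun t => 𝒢.transProb x₀ t x₀) :
    WeaklyRecurrent μ X x₀ := by
  have hmeas : ∀ t, MeasurableSet {ω | X t ω = x₀} := fun t =>
    hX.measurable t (MeasurableSpace.measurableSet_top (s := {x₀}))
  unfold WeaklyRecurrent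
  rw [lintegral_tsum fun t => (measurable_const.indicator (hmeas t)).aemeasurable]
  simp only [lintegral_indicator_const (hmeas _), one_mul]
  by_contra hne
  have hle : ∑' t, ENNReal.ofReal (𝒢.transProb x₀ t x₀) ≤ ∑' t, μ {ω | X t ω = x₀} :=
    ENNReal.tsum_le_tsum fun t => hX.ofReal_transProb_le h₀ t x₀
  refine hsum ((ENNReal.summable_toReal (ne_top_of_le_ne_top hne hle)).congr fun t => ?_)
  exact ENNReal.toReal_ofReal (𝒢.transProb_nonneg _ _ _)

end GrowingGraph

/-! ### Assembly of the three conclusions. -/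

theorem proposition1p13 (γ Δ ζ D₁ D₂ : ℝ) (hγ : 0 < γ) (hγ' : γ ≤ 1 / 2) (hζ : 0 < ζ) :
    ∃ δ₀ : ℝ, 0 < δ₀ ∧ δ₀ ≤ 1 / 2 ∧
      ∀ cHK : ℝ → ℝ, (∀ δ, 0 < δ → δ < 1 → 0 < cHK δ) →
      ∃ c : ℝ, 0 < c ∧
        ∀ (V : Type*) [Infinite V] (𝒢 : GrowingGraph V) (x₀ : V) (r ψ : ℝ → ℝ),
          x₀ ∈ 𝒢.verts 0 →
          𝒢.Lazy γ →
          𝒢.DegreeBound Δ →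
          𝒢.limit.VolumeDoubling D₁ →
          ContinuousOn ψ (Set.Ioi 0) → MonotoneOn ψ (Set.Ioi 0) → (∀ m, 0 < m → 0 < ψ m) →
          𝒢.limit.LLE x₀ ψ cHK →
          𝒢.BallLike x₀ r →
          𝒢.Regular ζ →
          𝒢.VolDoubling D₂ →
          (∃ t₀ : ℕ, ∀ t : ℕ, t₀ ≤ t → ∀ y ∈ 𝒢.verts t,
            (𝒢.limit.toSimple.dist x₀ y : ℝ) ≤ (1 - δ₀) * reach r ψ t →
              c / 𝒢.vol t ≤ 𝒢.transProb x₀ t y) ∧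
          (∃ c' : ℝ, 0 < c' ∧ ∀ t : ℕ, 2 ≤ t → ∀ y ∈ 𝒢.verts t,
            (𝒢.limit.toSimple.dist x₀ y : ℝ) ≤ (1 - δ₀) * reach r ψ t →
              c' / 𝒢.vol t ≤ 𝒢.transProb x₀ t y) ∧
          ((¬ Summable fun t : ℕ => 1 / 𝒢.vol t) →
            ∀ (Ω : Type*) [MeasurableSpace Ω] (μ : MeasureTheory.Measure Ω)
              [MeasureTheory.IsProbabilityMeasure μ] (X : ℕ → Ω → V),
              𝒢.IsWalk x₀ μ X → WeaklyRecurrent μ X x₀) := by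
  obtain ⟨C, hC, hen⟩ := GrowingGraph.eventually_energy_le (D₂ := D₂) hγ hζ
  obtain ⟨δ, R₀, hδ, hδ', hvol⟩ := MultiGraph.exists_volume_ball_ge D₁ (1 / (8 * C)) (by positivity)
  -- `δ₀ = 1 / 2` always works: the auxiliary `δ ≤ 1 / 4` carries the dependence on the constants
  -- and was fixed before `cHK`.
  refine ⟨1 / 2, by norm_num, le_rfl, fun cHK hcHK => ?_⟩
  have hcδ := hcHK δ hδ (by linarith)
  refine ⟨γ * cHK δ / 2, by positivity, ?_⟩
  intro V _ 𝒢 x₀ r ψ h₀ hlazy _ hD₁ hψc hψ hψ0 hLLE hr hreg hD₂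
  have hv : ∀ t, 0 < 𝒢.vol t := fun t => 𝒢.vol_pos (𝒢.verts_mono (Nat.zero_le t) h₀)
  have hhalf := hr.eventually_half_le h₀ hC hδ hδ' (hen V 𝒢 x₀ h₀ hlazy hreg hD₂)
    (hvol V 𝒢.limit 𝒢.limit_connected hr.ball_finite 𝒢.limit_degree_pos hD₁ x₀)
  obtain ⟨t₀, ht₀⟩ := hr.eventually_lower_bound h₀ hγ (by linarith) hlazy hψc hψ hψ0 hδ hδ' hcδ
    hLLE hhalf
  obtain ⟨b, hb, hb'⟩ := 𝒢.exists_pos_forall_lt h₀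
    (fun t y => (𝒢.limit.toSimple.dist x₀ y : ℝ) ≤ (1 - 1 / 2) * reach r ψ t)
    (fun t y hy => hr.transProb_pos h₀ hγ hlazy hψc hψ hψ0 (hcHK _ (by norm_num) (by norm_num))
      hLLE t hy) t₀
  set c' := min b (γ * cHK δ / 2) with hc'
  have hc'0 : 0 < c' := lt_min hb (by positivity)
  have hall : ∀ t : ℕ, ∀ y ∈ 𝒢.verts t,
      (𝒢.limit.toSimple.dist x₀ y : ℝ) ≤ (1 - 1 / 2) * reach r ψ t →
        c' / 𝒢.vol t ≤ 𝒢.transProb x₀ t y := by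
    intro t y hy hd
    rcases lt_or_ge t t₀ with h | h
    · exact (div_le_div_of_nonneg_right (min_le_left _ _) (hv t).le).trans (hb' t h y hy hd)
    · exact (div_le_div_of_nonneg_right (min_le_right _ _) (hv t).le).trans (ht₀ t h y hd)
  refine ⟨⟨t₀, fun t ht y _ hd => ht₀ t ht y hd⟩, ⟨c', hc'0, fun t _ => hall t⟩, ?_⟩
  intro hns Ω _ μ _ X hX
  refine hX.weaklyRecurrent h₀ fun hs => hns ?_
  refine (hs.mul_left c'⁻¹).of_nonneg_of_le (fun t => (one_div_pos.2 (hv t)).le) fun t => ?_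
  -- Thus `x₀` is admissible at every time, and `1 / v(t)` is dominated by a multiple of the return
  -- probability.
  have hreach : 0 ≤ reach r ψ t := Real.sSup_nonneg fun _ h => h.1.le
  have := hall t x₀ (𝒢.verts_mono (Nat.zero_le t) h₀) (by
    rw [SimpleGraph.dist_self, Nat.cast_zero]; positivity)
  rw [le_inv_mul_iff₀ hc'0]
  rwa [mul_one_div]
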